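/- **Setting.** Let $\Omega\subseteq\mathbb R^m$ be open (for instance bounded with smooth boundary), $p,n\in\mathbb N=\{0,1,2,\dots\}$ and $t^\star>0$. Let $a_\beta\in C_b^\infty(\Omega)$ for $|\beta|\le p$ (smooth complex functions, all derivatives bounded on $\Omega$) and let $\alpha\in W^{np,\infty}(\Omega)$ be complex-valued. Let $\mathcal L:D(\mathcal L)\to L^2(\Omega)$ be the generator of a $C_0$-semigroup $(e^{t\mathcal L})_{t\ge0}$ on $L^2(\Omega)$ which is the differential operator $\mathcal Lv=\sum_{|\beta|\le p}a_\beta\,\partial^\beta v$ for all $v\in D(\mathcal L)\cap H^p(\Omega)$; boundary conditions, if any, are encoded in $D(\mathcal L)$. Put $X_j=H^{jp}(\Omega)\cap D(\mathcal L^j)$, $0\le j\le n$, and assume: * (well-posedness in the Sobolev spaces) for $0\le j\le n$ and $v\in X_j$, $t\mapsto e^{t\mathcal L}v$ is a continuous map from $[0,t^\star]$ to $H^{jp}(\Omega)$; * (multiplication by $\alpha$ respects the boundary conditions) for $0\le j\le n$ and $v\in X_j$ with $\alpha v\in H^{jp}(\Omega)$, one has $\alpha v\in D(\mathcal L^j)$.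 (This holds automatically if $H^p(\Omega)\subseteq D(\mathcal L)$, since then $X_j=H^{jp}(\Omega)$.) Let $u_0\in X_n$. For $\omega>0$ let $T^0e^{t\mathcal L}u_0=e^{t\mathcal L}u_0$ and $$T^{d}e^{t\mathcal L}u_0=\int_0^t e^{(t-\tau)\mathcal L}\,\alpha\, e^{i\omega\tau}\,\bigl(T^{d-1}e^{\tau\mathcal L}u_0\bigr)\,d\tau,\qquad d\ge1 .$$ **Notation.** All operators are taken on their natural domains in $L^2(\Omega)$. Put $\mathrm{ad}_{\mathcal L}^0(G)=G$ and $\mathrm{ad}_{\mathcal L}^{k+1}(G)=\mathcal L\,\mathrm{ad}_{\mathcal L}^{k}(G)-\mathrm{ad}_{\mathcal L}^{k}(G)\,\mathcal L$. For a multi-index $\mathbf k=\mathbf k^d=(k_1,\dots,k_d)\in\mathbb N^d$ put $|\mathbf k|=k_1+\dots+k_d$ and $$\mathcal N_{k_l}^{k_l}=\mathrm{ad}_{\mathcal L}^{k_l}(\alpha),\qquad \mathcal N_{k_l}^{k_r}=\mathrm{ad}_{\mathcal L}^{k_r}\bigl(\alpha\,\mathcal N_{k_l}^{k_{r-1}}\bigr)\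 (l<r),\qquad \mathcal N_{k_l}^{k_r}=\mathrm{Id}\ (l>r),$$ $$a_j^\ell=\prod_{r=0}^{j-1}(j-r)^{-(k_{\ell-r}+1)},\quad a_0^\ell=1,\qquad b_j^\ell=j^{-k_\ell}\prod_{r=1}^{j-1}(j-r)^{-(k_{\ell-r}+1)}\ (j\ge1),\quad b_0^\ell=1,$$ $$\mathcal F_0=\mathrm{Id},\qquad \mathcal F_\ell=-\sum_{m=0}^{\ell-1}a_{\ell-m}^\ell\,\mathcal N_{k_{m+1}}^{k_\ell}\mathcal F_m\quad(\ell\ge1).$$ **Theorem.** Let $0\le d\le n$. 1. For every $\mathbf k\in\mathbb N^d$ with $|\mathbf k|\le n-d+1$ and every $0\le\ell\le d$, the vector $u_0$ lies in the domain of $\mathcal F_\ell$, $e^{t\mathcal L}\mathcal F_\ell u_0$ lies in the domain of $\mathcal N_{k_{\ell+1}}^{k_d}$ for all $t\in[0,t^\star]$, and $t\mapsto\mathcal N_{k_{\ell+1}}^{k_d}e^{t\mathcal L}\mathcal F_\ell u_0$ is continuous from $[0,t^\star]$ to $L^2(\Omega)$. 2. For all $\omega>0$ and $t\in[0,t^\star]$,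 $\;T^de^{t\mathcal L}u_0=\mathcal S_n^d(t)+E_n^d(t)$, where $$\mathcal S_n^d(t)=\sum_{|\mathbf k^d|=0}^{n-d}\frac1{(i\omega)^{d+|\mathbf k^d|}}\sum_{\ell=0}^d a_{d-\ell}^d\,e^{(d-\ell)i\omega t}\,\mathcal N_{k_{\ell+1}}^{k_d}e^{t\mathcal L}\mathcal F_\ell u_0,$$ $E_n^0\equiv0$ and, for $d\ge1$, $$E_n^d(t)=\frac1{(i\omega)^n}\sum_{|\mathbf k^d|=n-d+1}\ \sum_{\ell=0}^{d-1}b_{d-\ell}^d\int_0^t e^{(t-\tau)\mathcal L}\,\mathcal N_{k_{\ell+1}}^{k_d}\,e^{\tau\mathcal L}\mathcal F_\ell u_0\;e^{(d-\ell)i\omega\tau}\,d\tau+\int_0^te^{(t-\tau)\mathcal L}\,\alpha\, e^{i\omega\tau}E_n^{d-1}(\tau)\,d\tau .$$ 3. For every $\omega>0$ the function $t\mapsto T^de^{t\mathcal L}u_0$ belongs to $Y=C([0,t^\star];L^2(\Omega))$, and there is a constant $C$, independent of $\omega$ (it depends on $d,t^\star,\mathcal L,u_0,\alpha$), such that $\|T^de^{\,\cdot\,\mathcal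 L}u_0\|_Y=\max_{0\le t\le t^\star}\|T^de^{t\mathcal L}u_0\|_{L^2(\Omega)}\le\omega^{-d}\,C$ for all $\omega>0$. -/

import Mathlib

open MeasureTheory Set Filter Topology
open scoped ENNReal

noncomputable section

namespace OscInt

/-! ### Weak derivatives and Sobolev spaces on an open set of `ℝ^m` -/

/-- `ℝ^m` with the Euclidean norm. -/
abbrev Space (m : ℕ) := EuclideanSpace ℝ (Fin m)

/-- The complex Hilbert space `L²(Ω)`. -/
abbrev L2 {m : ℕ} (Ω : Set (Space m)) := Lp ℂ 2 (volume.restrict Ω)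

/-- The space `L^∞(Ω)` of complex functions. -/
abbrev Linf {m : ℕ} (Ω : Set (Space m)) := Lp ℂ ∞ (volume.restrict Ω)

/-- The classical partial derivative in the `i`-th coordinate. -/
def partialDeriv {m : ℕ} (i : Fin m) (φ : Space m → ℝ) : Space m → ℝ :=
  fun x => fderiv ℝ φ x (EuclideanSpace.single i 1)

/-- The classical derivative `∂₁^{β₁} ⋯ ∂ₘ^{βₘ} φ` for a multi-index `β`. -/
def multiDeriv {m : ℕ} (β : Fin m → ℕ) (φ : Space m → ℝ) : Space m → ℝ :=
  (List.finRange m).foldr (fun i ψ => (partialDeriv i)^[β i] ψ) φ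

section

open scoped ContDiff

/-- `g` is the weak derivative `∂^β f` in `Ω` (used only for `f`, `g` locally integrable in `Ω`). -/
def HasWeakDeriv {m : ℕ} (Ω : Set (Space m)) (β : Fin m → ℕ) (f g : Space m → ℂ) : Prop :=
  ∀ φ : Space m → ℝ, ContDiff ℝ ∞ φ → HasCompactSupport φ → tsupport φ ⊆ Ω →
    ∫ x in Ω, multiDeriv β φ x • f x = (-1) ^ (∑ i, β i) * ∫ x in Ω, φ x • g x

end

/-- `v ∈ H^s(Ω)`. -/
def MemH {m : ℕ} (Ω : Set (Space m)) (s : ℕ) (v : L2 Ω) : Prop :=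
  ∀ β : Fin m → ℕ, ∑ i, β i ≤ s → ∃ g : L2 Ω, HasWeakDeriv Ω β v g

/-- `α ∈ W^{s,∞}(Ω)`. -/
def MemWinf {m : ℕ} (Ω : Set (Space m)) (s : ℕ) (α : Linf Ω) : Prop :=
  ∀ β : Fin m → ℕ, ∑ i, β i ≤ s → ∃ g : Linf Ω, HasWeakDeriv Ω β α g

/-- `u` maps `J` continuously into `H^s(Ω)`: every weak derivative of order at most `s` of `u t`
exists in `L²(Ω)` and depends continuously on `t ∈ J` in the norm of `L²(Ω)`. -/
def ContinuousOnH {m : ℕ} (Ω : Set (Space m)) (s : ℕ) (u : ℝ → L2 Ω) (J : Set ℝ) : Prop :=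
  ∀ β : Fin m → ℕ, ∑ i, β i ≤ s →
    ∃ g : ℝ → L2 Ω, ContinuousOn g J ∧ ∀ t ∈ J, HasWeakDeriv Ω β (u t) (g t)

section

open scoped ContDiff

/-- `a ∈ C_b^∞(Ω)`: smooth in the open set `Ω`, with all derivatives bounded there. -/
def MemCbInf {m : ℕ} (Ω : Set (Space m)) (a : Space m → ℂ) : Prop :=
  ContDiffOn ℝ ∞ a Ω ∧ ∀ k : ℕ, ∃ C : ℝ, ∀ x ∈ Ω, ‖iteratedFDeriv ℝ k a x‖ ≤ C

end

/-- `w = ∑_{|β| ≤ p} a_β ∂^β v` in `Ω`, with weak derivatives `∂^β v ∈ L²(Ω)`. -/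
def IsDiffExpr {m : ℕ} (Ω : Set (Space m)) (p : ℕ) (a : (Fin m → ℕ) → Space m → ℂ)
    (v w : L2 Ω) : Prop :=
  ∃ g : (Fin m → ℕ) → L2 Ω, (∀ β, ∑ i, β i ≤ p → HasWeakDeriv Ω β v (g β)) ∧
    w =ᵐ[volume.restrict Ω]
      fun x => ∑ s ∈ Finset.range (p + 1), ∑ β ∈ Finset.piAntidiag Finset.univ s, a β x * g β x

/-- Multiplication by `α ∈ L^∞(Ω)` as a bounded operator on `L²(Ω)`. -/
def mulOp {m : ℕ} {Ω : Set (Space m)} (α : Linf Ω) : L2 Ω →L[ℂ] L2 Ω :=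
  (ContinuousLinearMap.mul ℂ ℂ).holderL (volume.restrict Ω) ∞ 2 2 α

/-! ### Unbounded operators on their natural domains -/

/-- The composition `g ∘ f` with domain `{v ∈ D(f) : f v ∈ D(g)}`. -/
def pcomp {H : Type*} [NormedAddCommGroup H] [NormedSpace ℂ H] (g f : H →ₗ.[ℂ] H) :
    H →ₗ.[ℂ] H :=
  g.comp (f.domRestrict ((g.domain.comap f.toFun).map f.domain.subtype)) (by
    rintro ⟨v, ⟨⟨w, hw, rfl⟩, hv⟩⟩
    exact hw)

theorem mem_pcomp_domain {H : Type*} [NormedAddCommGroup H] [NormedSpace ℂ H]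
    (g f : H →ₗ.[ℂ] H) (v : H) :
    v ∈ (pcomp g f).domain ↔ ∃ h : v ∈ f.domain, f ⟨v, h⟩ ∈ g.domain := by
  constructor
  · rintro ⟨⟨w, hw, rfl⟩, hv⟩
    exact ⟨hv, hw⟩
  · rintro ⟨h, hg⟩
    exact ⟨⟨⟨v, h⟩, hg, rfl⟩, h⟩

theorem pcomp_apply {H : Type*} [NormedAddCommGroup H] [NormedSpace ℂ H]
    (g f : H →ₗ.[ℂ] H) (v : H) (hv : v ∈ (pcomp g f).domain) (h : v ∈ f.domain)
    (hg : f ⟨v, h⟩ ∈ g.domain) : pcomp g f ⟨v, hv⟩ = g ⟨f ⟨v, h⟩, hg⟩ := rfl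

/-- The identity as an everywhere defined operator. -/
def pid (H : Type*) [NormedAddCommGroup H] [NormedSpace ℂ H] : H →ₗ.[ℂ] H :=
  (LinearMap.id : H →ₗ[ℂ] H).toPMap ⊤

/-- A bounded operator as an everywhere defined partial operator. -/
def ofBounded {H : Type*} [NormedAddCommGroup H] [NormedSpace ℂ H] (B : H →L[ℂ] H) :
    H →ₗ.[ℂ] H :=
  (B : H →ₗ[ℂ] H).toPMap ⊤

/-- The power `L^j`, with its natural domain `D(L^j)`. -/
def ppow {H : Type*} [NormedAddCommGroup H] [NormedSpace ℂ H] (L : H →ₗ.[ℂ] H) :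
    ℕ → (H →ₗ.[ℂ] H)
  | 0 => pid H
  | j + 1 => pcomp (ppow L j) L

open Classical in
/-- The value `f v`, extended by `0` to vectors `v` outside the domain of `f`. -/
def papply {H : Type*} [NormedAddCommGroup H] [NormedSpace ℂ H] (f : H →ₗ.[ℂ] H) (v : H) : H :=
  if h : v ∈ f.domain then f ⟨v, h⟩ else 0

/-- Iterated commutators `ad_L^0(G) = G`, `ad_L^{k+1}(G) = L ad_L^k(G) - ad_L^k(G) L`. -/
def adPow {H : Type*} [NormedAddCommGroup H] [NormedSpace ℂ H] (L G : H →ₗ.[ℂ] H) :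
    ℕ → (H →ₗ.[ℂ] H)
  | 0 => G
  | k + 1 => pcomp L (adPow L G k) - pcomp (adPow L G k) L

/-! ### Semigroups -/

/-- `(S t)_{t ≥ 0}` is a strongly continuous semigroup (values at `t < 0` are irrelevant). -/
structure IsC0Semigroup {H : Type*} [NormedAddCommGroup H] [NormedSpace ℂ H]
    (S : ℝ → H →L[ℂ] H) : Prop where
  zero : S 0 = ContinuousLinearMap.id ℂ H
  add : ∀ s t : ℝ, 0 ≤ s → 0 ≤ t → S (s + t) = (S s).comp (S t)
  cont : ∀ v : H, ContinuousOn (fun t => S t v) (Ici 0)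

/-- `L` is the infinitesimal generator of `S`: `v ∈ D(L)` and `L v = w` if and only if
`(S t v - v) / t → w` as `t → 0+`. -/
def IsGenerator {H : Type*} [NormedAddCommGroup H] [NormedSpace ℂ H]
    (L : H →ₗ.[ℂ] H) (S : ℝ → H →L[ℂ] H) : Prop :=
  ∀ v w : H, (v, w) ∈ L.graph ↔
    Tendsto (fun t : ℝ => (t : ℂ)⁻¹ • (S t v - v)) (𝓝[>] 0) (𝓝 w)

/-! ### The operators and coefficients of the expansion

A multi-index `(k_1, …, k_d)` is a function `k : ℕ → ℕ` supported in `{1, …, d}`, so that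
`Finset.piAntidiag (Finset.Icc 1 d) s` is the set of all multi-indices with `|k| = s`. -/

/-- `N_{k_l}^{k_r} = ad_L^{k_r}(α ad_L^{k_{r-1}}(⋯ α ad_L^{k_l}(α)))`, and the identity if `l > r`
(for `l ≥ 1`). -/
def opN {H : Type*} [NormedAddCommGroup H] [NormedSpace ℂ H] (L : H →ₗ.[ℂ] H) (α : H →L[ℂ] H)
    (k : ℕ → ℕ) (l : ℕ) : ℕ → (H →ₗ.[ℂ] H)
  | 0 => pid H
  | r + 1 =>
    if r + 1 < l then pid H
    else adPow L (pcomp (ofBounded α) (opN L α k l r)) (k (r + 1))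

/-- `a_j^ℓ = 1 / ∏_{r=0}^{j-1} (j-r)^{k_{ℓ-r}+1}` (so `a_0^ℓ = 1`), for `j ≤ ℓ`. -/
def coefA (k : ℕ → ℕ) (l j : ℕ) : ℚ :=
  1 / ∏ r ∈ Finset.range j, ((j - r : ℕ) : ℚ) ^ (k (l - r) + 1)

/-- `b_j^ℓ = 1 / (j^{k_ℓ} ∏_{r=1}^{j-1} (j-r)^{k_{ℓ-r}+1})` for `1 ≤ j ≤ ℓ`, and `b_0^ℓ = 1`. -/
def coefB (k : ℕ → ℕ) (l j : ℕ) : ℚ :=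
  if j = 0 then 1
  else 1 / ((j : ℚ) ^ k l * ∏ r ∈ Finset.Ico 1 j, ((j - r : ℕ) : ℚ) ^ (k (l - r) + 1))

/-- `F_0 = Id`, `F_ℓ = -∑_{m=0}^{ℓ-1} a_{ℓ-m}^ℓ N_{k_{m+1}}^{k_ℓ} F_m`. -/
def opF {H : Type*} [NormedAddCommGroup H] [NormedSpace ℂ H] (L : H →ₗ.[ℂ] H) (α : H →L[ℂ] H)
    (k : ℕ → ℕ) : ℕ → (H →ₗ.[ℂ] H)
  | 0 => pid H
  | l + 1 =>
    -∑ m : Fin (l + 1),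
      ((coefA k (l + 1) (l + 1 - m) : ℚ) : ℂ) •
        pcomp (opN L α k (m + 1) (l + 1)) (opF L α k m)
termination_by l => l
decreasing_by exact m.2

/-- The nested integral `T^d e^{tL} u₀`: `T^0 e^{tL} u₀ = e^{tL} u₀` and
`T^{d+1} e^{tL} u₀ = ∫_0^t e^{(t-τ)L} α e^{iωτ} (T^d e^{τL} u₀) dτ`. -/
def nestedT {H : Type*} [NormedAddCommGroup H] [NormedSpace ℂ H] (S : ℝ → H →L[ℂ] H)
    (α : H →L[ℂ] H) (ω : ℝ) (u₀ : H) : ℕ → ℝ → H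
  | 0, t => S t u₀
  | d + 1, t => ∫ τ in (0 : ℝ)..t,
      S (t - τ) (α (Complex.exp (Complex.I * ω * τ) • nestedT S α ω u₀ d τ))

/-- The finite series `S_n^d(t)`. -/
def seriesS {H : Type*} [NormedAddCommGroup H] [NormedSpace ℂ H] (L : H →ₗ.[ℂ] H)
    (S : ℝ → H →L[ℂ] H) (α : H →L[ℂ] H) (ω : ℝ) (u₀ : H) (n d : ℕ) (t : ℝ) : H :=
  ∑ s ∈ Finset.range (n - d + 1), ∑ k ∈ Finset.piAntidiag (Finset.Icc 1 d) s,
    (1 / (Complex.I * ω) ^ (d + s)) • ∑ l ∈ Finset.range (d + 1),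
      (((coefA k d (d - l) : ℚ) : ℂ) * Complex.exp (((d - l : ℕ) : ℂ) * Complex.I * ω * t)) •
        papply (opN L α k (l + 1) d) (S t (papply (opF L α k l) u₀))

/-- The remainder `E_n^d(t)`, with `E_n^0 = 0`. -/
def remE {H : Type*} [NormedAddCommGroup H] [NormedSpace ℂ H] (L : H →ₗ.[ℂ] H)
    (S : ℝ → H →L[ℂ] H) (α : H →L[ℂ] H) (ω : ℝ) (u₀ : H) (n : ℕ) : ℕ → ℝ → H
  | 0, _ => 0
  | d + 1, t =>
    (1 / (Complex.I * ω) ^ n) •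
      (∑ k ∈ Finset.piAntidiag (Finset.Icc 1 (d + 1)) (n - (d + 1) + 1),
        ∑ l ∈ Finset.range (d + 1), ((coefB k (d + 1) (d + 1 - l) : ℚ) : ℂ) •
          ∫ τ in (0 : ℝ)..t, Complex.exp (((d + 1 - l : ℕ) : ℂ) * Complex.I * ω * τ) •
            S (t - τ) (papply (opN L α k (l + 1) (d + 1)) (S τ (papply (opF L α k l) u₀))))
    + ∫ τ in (0 : ℝ)..t, S (t - τ) (α (Complex.exp (Complex.I * ω * τ) • remE L S α ω u₀ n d τ))

end OscInt

end

open OscInt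

open MeasureTheory Set Filter Topology
open scoped ENNReal

noncomputable section

namespace OscInt

section Semigroup

variable {H : Type*} [NormedAddCommGroup H] [NormedSpace ℂ H]
  {S : ℝ → H →L[ℂ] H} {L : H →ₗ.[ℂ] H}

/-! ### Strongly continuous semigroups -/

/-! For fixed w, the curve S(t-τ) A S(τ) w has τ-derivative -S(t-τ) [L, A] S(τ) w. Integrating
e^{cτ} S(t-τ) A S(τ) w by parts over [0, t] thus trades a factor 1/c for one commutator, with
boundary terms e^{ct} A S(t) w and S(t) A w (`HasOrder.integral_exp_smul`). Each Duhamel integral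
contributes one more phase e^{iωτ}, so only c = q iω with q ≥ 1 occurs: there is no resonance.

The expansion (`nestedT_eq`) follows by induction on d. T^{d+1} is the Duhamel integral of S_n^d +
E_n^d. In a term of S_n^d with multi-index k one takes A = α N_{k_{l+1}}^{k_d} and integrates by
parts K = n - d - |k| times. The commutator ad_L^j(A) is the operator N of the extended multi-index
(k, j); the factors c^{-(j+1)} turn the coefficients a of depth d into those of depth d+1, and the
factor c^{-K} of the remaining integral produces b. The boundary terms at τ = 0, summed over l, form
F_{d+1} by its very definition and give the new summand l = d+1 (`duhamel_sum_expTerm`). The bound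
is the case n = d: only k = 0 survives in the series, with factor ω^{-d}, and all remaining
integrals are bounded uniformly in ω.

The rest is regularity. A k-fold commutator with L is counted as an operator of order k in L,
without using any cancellation, and u₀ has n levels to spend. `IsRegularityScale` axiomatises
continuous curves into spaces X_j. `HasOrder` describes operators that lose r levels and commute
with integration in time; this makes τ ↦ A S(τ) w differentiable although A is not known to be
closed. Both properties pass from L (closed, so Hille's theorem applies) and α (bounded) to
compositions and commutators. `isRegularityScale_sobolevScale` checks the axioms for H^{jp}(Ω) ∩
D(L^j); its core is the product rule for weak derivatives, proved by mollification. -/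

theorem papply_eq {f : H →ₗ.[ℂ] H} {v : H} (h : v ∈ f.domain) : papply f v = f ⟨v, h⟩ :=
  dif_pos h

theorem mem_graph_papply {f : H →ₗ.[ℂ] H} {v : H} (h : v ∈ f.domain) :
    (v, papply f v) ∈ f.graph := by
  rw [papply_eq h]
  exact f.mem_graph ⟨v, h⟩

theorem mem_domain_and_papply_eq {f : H →ₗ.[ℂ] H} {v w : H} (h : (v, w) ∈ f.graph) :
    v ∈ f.domain ∧ papply f v = w := by
  obtain ⟨y, hy, hw⟩ := (LinearPMap.mem_graph_iff f).1 h
  simp only at hy hw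
  subst hy
  exact ⟨y.2, by rw [papply_eq y.2, hw]⟩

/-- The bounded operator S t commutes with S s, so it carries the difference quotients of v to those
of S t v. -/
theorem IsGenerator.map (hS : IsC0Semigroup S) (hL : IsGenerator L S) {v : H} (hv : v ∈ L.domain)
    {t : ℝ} (ht : 0 ≤ t) : S t v ∈ L.domain ∧ papply L (S t v) = S t (papply L v) := by
  refine mem_domain_and_papply_eq ((hL _ _).2 ?_)
  have h := ((S t).continuous.tendsto _).comp ((hL _ _).1 (mem_graph_papply hv))
  refine h.congr' ?_
  filter_upwards [self_mem_nhdsWithin] with s hs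
  have hs : 0 ≤ s := le_of_lt hs
  have e : S t (S s v) = S s (S t v) := by
    have h1 := hS.add t s ht hs
    have h2 := hS.add s t hs ht
    rw [add_comm, h2] at h1
    exact (congrArg (fun A : H →L[ℂ] H => A v) h1).symm
  simp [map_smul, map_sub, e]

theorem tendsto_slope_iff_real {l : Filter ℝ} {x : ℝ → H} {w : H} :
    Tendsto (fun t : ℝ => (t : ℂ)⁻¹ • x t) l (𝓝 w) ↔ Tendsto (fun t : ℝ => t⁻¹ • x t) l (𝓝 w) := by
  refine tendsto_congr fun t => ?_
  rw [← Complex.coe_smul, Complex.ofReal_inv]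

theorem hasDerivWithinAt_Ioi_iff_tendsto {f : ℝ → H} {w : H} {x : ℝ} :
    HasDerivWithinAt f w (Ioi x) x ↔
      Tendsto (fun h : ℝ => h⁻¹ • (f (x + h) - f x)) (𝓝[>] 0) (𝓝 w) := by
  rw [hasDerivWithinAt_iff_tendsto_slope' (by simp)]
  have e : 𝓝[>] x = Filter.map (fun h => x + h) (𝓝[>] (0 : ℝ)) := by
    simp
  rw [e, tendsto_map'_iff]
  refine tendsto_congr fun h => ?_
  simp [slope, vsub_eq_sub]

theorem IsC0Semigroup.intervalIntegrable (hS : IsC0Semigroup S) (v : H) {a b : ℝ} (ha : 0 ≤ a)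
    (hb : 0 ≤ b) : IntervalIntegrable (fun s => S s v) volume a b :=
  ((hS.cont v).mono fun _ hx => (le_min ha hb).trans hx.1).intervalIntegrable

theorem ppow_succ_domain_le (L : H →ₗ.[ℂ] H) (j : ℕ) : (ppow L (j + 1)).domain ≤ (ppow L j).domain := by
  induction j with
  | zero => exact fun v _ => Submodule.mem_top
  | succ j ih =>
    intro v hv
    obtain ⟨h, h'⟩ := (mem_pcomp_domain _ _ _).1 hv
    exact (mem_pcomp_domain _ _ _).2 ⟨h, ih h'⟩

/-- By the semigroup law the right difference quotient at t is the one at 0 of the vector S t v.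
Only the right derivative is available so directly; the two-sided one is recovered from the integral
formula in `IsGenerator.hasDerivAt`. -/
theorem IsGenerator.hasDerivWithinAt (hS : IsC0Semigroup S) (hL : IsGenerator L S) {v : H}
    (hv : v ∈ L.domain) {t : ℝ} (ht : 0 ≤ t) :
    HasDerivWithinAt (fun s => S s v) (S t (papply L v)) (Ioi t) t := by
  obtain ⟨h1, h2⟩ := hL.map hS hv ht
  rw [hasDerivWithinAt_Ioi_iff_tendsto, ← tendsto_slope_iff_real, ← h2]
  refine ((hL _ _).1 (mem_graph_papply h1)).congr' ?_
  filter_upwards [self_mem_nhdsWithin] with s hs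
  have e : S (t + s) v = S s (S t v) := by
    rw [add_comm, hS.add s t (le_of_lt hs) ht]; rfl
  rw [e]

theorem IsGenerator.map_ppow_domain (hS : IsC0Semigroup S) (hL : IsGenerator L S) {j : ℕ} {v : H}
    (hv : v ∈ (ppow L j).domain) {t : ℝ} (ht : 0 ≤ t) : S t v ∈ (ppow L j).domain := by
  induction j generalizing v with
  | zero => exact Submodule.mem_top
  | succ j ih =>
    obtain ⟨h, h'⟩ := (mem_pcomp_domain _ _ _).1 hv
    obtain ⟨h1, h2⟩ := hL.map hS h ht
    refine (mem_pcomp_domain _ _ _).2 ⟨h1, ?_⟩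
    rw [← papply_eq h1, h2, papply_eq h]
    exact ih h'

variable [CompleteSpace H]

theorem IsC0Semigroup.exists_bound (hS : IsC0Semigroup S) (T : ℝ) :
    ∃ M : ℝ, 0 ≤ M ∧ ∀ t ∈ Icc 0 T, ‖S t‖ ≤ M := by
  have h : ∀ v : H, ∃ C, ∀ t : Icc 0 T, ‖S t v‖ ≤ C := by
    intro v
    obtain ⟨C, hC⟩ := isCompact_Icc.exists_bound_of_continuousOn
      ((hS.cont v).mono (fun _ hx => hx.1 : Icc 0 T ⊆ Ici 0))
    exact ⟨C, fun t => hC t t.2⟩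
  obtain ⟨M, hM⟩ := banach_steinhaus h
  exact ⟨max M 0, le_max_right _ _, fun t ht => (hM ⟨t, ht⟩).trans (le_max_left _ _)⟩

/-- Joint continuity of `(s, v) ↦ S s v` on `[0, ∞) × H`. -/
theorem IsC0Semigroup.tendsto (hS : IsC0Semigroup S) {ι : Type*} {l : Filter ι} {s : ι → ℝ}
    {v : ι → H} {s₀ : ℝ} {v₀ : H} (hs₀ : 0 ≤ s₀) (hs : Tendsto s l (𝓝 s₀))
    (hs' : ∀ᶠ i in l, 0 ≤ s i) (hv : Tendsto v l (𝓝 v₀)) :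
    Tendsto (fun i => S (s i) (v i)) l (𝓝 (S s₀ v₀)) := by
  -- Split S(s_i) v_i = S(s_i) v₀ + S(s_i)(v_i - v₀). Near s₀ the operators are bounded by M, so the
  -- second summand tends to 0.
  obtain ⟨M, hM0, hM⟩ := hS.exists_bound (s₀ + 1)
  have h1 : Tendsto (fun i => S (s i) v₀) l (𝓝 (S s₀ v₀)) :=
    ((hS.cont v₀) s₀ hs₀).tendsto.comp (tendsto_nhdsWithin_iff.2 ⟨hs, hs'⟩)
  have h2 : Tendsto (fun i => S (s i) (v i - v₀)) l (𝓝 0) := by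
    have h3 : Tendsto (fun i => M * ‖v i - v₀‖) l (𝓝 0) := by
      have := ((hv.sub_const v₀).norm).const_mul M
      simpa using this
    refine squeeze_zero_norm' ?_ h3
    filter_upwards [hs', hs.eventually (gt_mem_nhds (lt_add_one s₀))] with i h0 h1
    exact (S (s i)).le_of_opNorm_le (hM _ ⟨h0, h1.le⟩) _
  have h4 := h1.add h2
  simp only [map_sub, add_sub_cancel, add_zero] at h4
  exact h4

theorem IsC0Semigroup.continuousOn_comp (hS : IsC0Semigroup S) {X : Type*} [TopologicalSpace X]
    {A : Set X} {s : X → ℝ} {f : X → H} (hs : ContinuousOn s A) (hs' : ∀ x ∈ A, 0 ≤ s x)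
    (hf : ContinuousOn f A) : ContinuousOn (fun x => S (s x) (f x)) A := fun x hx =>
  hS.tendsto (hs' x hx) (hs x hx) (eventually_mem_nhdsWithin.mono hs') (hf x hx)

theorem IsGenerator.sub_eq_integral (hS : IsC0Semigroup S) (hL : IsGenerator L S) {v : H}
    (hv : v ∈ L.domain) {t : ℝ} (ht : 0 ≤ t) :
    S t v - v = ∫ s in (0 : ℝ)..t, S s (papply L v) := by
  rw [intervalIntegral.integral_eq_sub_of_hasDeriv_right (f := fun s => S s v)]
  · simp [hS.zero]
  · exact (hS.cont v).mono fun x hx => by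
      rw [uIcc_of_le ht] at hx; exact hx.1
  · intro x hx
    rw [min_eq_left ht] at hx
    exact hL.hasDerivWithinAt hS hv hx.1.le
  · exact hS.intervalIntegrable _ le_rfl ht

theorem hasDerivAt_integral_of_continuousOn {f : ℝ → H} {T : ℝ} (hf : ContinuousOn f (Icc 0 T))
    {t : ℝ} (ht : t ∈ Ioo 0 T) : HasDerivAt (fun s => ∫ x in (0 : ℝ)..s, f x) (f t) t := by
  have hn : Icc 0 T ∈ 𝓝 t := Icc_mem_nhds ht.1 ht.2
  refine intervalIntegral.integral_hasDerivAt_right ?_ ?_ (hf.continuousAt hn)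
  · refine (hf.mono ?_).intervalIntegrable
    rw [uIcc_of_le ht.1.le]
    exact Icc_subset_Icc_right ht.2.le
  · exact ⟨Icc 0 T, hn, hf.aestronglyMeasurable measurableSet_Icc⟩

/-- The orbit is v plus the integral of a continuous function, hence differentiable on both sides.
The left derivative is needed for S (t - s), whose time runs backwards. -/
theorem IsGenerator.hasDerivAt (hS : IsC0Semigroup S) (hL : IsGenerator L S) {v : H}
    (hv : v ∈ L.domain) {t : ℝ} (ht : 0 < t) :
    HasDerivAt (fun s => S s v) (S t (papply L v)) t := by
  have h1 := hasDerivAt_integral_of_continuousOn (f := fun s => S s (papply L v)) (T := t + 1)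
    ((hS.cont _).mono fun _ hx => hx.1) ⟨ht, lt_add_one t⟩
  refine (h1.add_const v).congr_of_eventuallyEq ?_
  filter_upwards [lt_mem_nhds ht] with s hs
  rw [← hL.sub_eq_integral hS hv hs.le, sub_add_cancel]

/-- Converse of `IsGenerator.sub_eq_integral`: divide by t and let t → 0+. The pair of statements
describes the graph by identities that are closed conditions. -/
theorem IsGenerator.mem_graph_of_sub_eq_integral (hS : IsC0Semigroup S) (hL : IsGenerator L S)
    {v w : H} (h : ∀ t, 0 ≤ t → S t v - v = ∫ s in (0 : ℝ)..t, S s w) : (v, w) ∈ L.graph := by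
  rw [hL, tendsto_slope_iff_real]
  have h1 : HasDerivWithinAt (fun t => ∫ s in (0 : ℝ)..t, S s w) w (Ioi 0) 0 := by
    have := intervalIntegral.integral_hasDerivWithinAt_right (a := 0) (b := 0) (s := Ici 0)
      (t := Ioi 0) (f := fun s => S s w) (by simp) ?_ ?_
    · simpa [hS.zero] using this
    · exact ⟨Ioi 0, self_mem_nhdsWithin, ((hS.cont w).mono Ioi_subset_Ici_self).aestronglyMeasurable
        measurableSet_Ioi⟩
    · exact (hS.cont w 0 self_mem_Ici).mono Ioi_subset_Ici_self
  rw [hasDerivWithinAt_Ioi_iff_tendsto] at h1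
  refine h1.congr' ?_
  filter_upwards [self_mem_nhdsWithin] with t ht
  rw [h t (le_of_lt ht)]
  simp

/-- The graph is the intersection over t ≥ 0 of the sets S t v - v = ∫₀ᵗ S s w ds, and both sides
depend continuously on (v, w). -/
theorem IsGenerator.isClosed_graph (hS : IsC0Semigroup S) (hL : IsGenerator L S) :
    IsClosed (L.graph : Set (H × H)) := by
  have e : (L.graph : Set (H × H)) =
      ⋂ t ∈ Ici (0 : ℝ), {x : H × H | S t x.1 - x.1 = ∫ s in (0 : ℝ)..t, S s x.2} := by
    ext ⟨v, w⟩
    simp only [mem_iInter, mem_ofPred_eq, SetLike.mem_coe]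
    refine ⟨fun h t ht => ?_, fun h => hL.mem_graph_of_sub_eq_integral hS h⟩
    obtain ⟨h1, h2⟩ := mem_domain_and_papply_eq h
    rw [hL.sub_eq_integral hS h1 ht, h2]
  rw [e]
  refine isClosed_biInter fun t ht => isClosed_eq (by fun_prop) ?_
  obtain ⟨M, -, hM⟩ := hS.exists_bound t
  have hi : ∀ v, IntervalIntegrable (fun s => S s v) volume 0 t := fun v =>
    hS.intervalIntegrable v le_rfl ht
  let I : H →ₗ[ℂ] H :=
    { toFun := fun v => ∫ s in (0 : ℝ)..t, S s v
      map_add' := fun v w => by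
        simp only [map_add]; exact intervalIntegral.integral_add (hi v) (hi w)
      map_smul' := fun c v => by
        simp only [map_smul, RingHom.id_apply]; exact intervalIntegral.integral_smul c _ }
  have hI : Continuous I := by
    refine AddMonoidHomClass.continuous_of_bound I (M * |t - 0|) fun v => ?_
    have : ‖I v‖ ≤ (M * ‖v‖) * |t - 0| := by
      refine intervalIntegral.norm_integral_le_of_norm_le_const fun s hs => ?_
      rw [uIoc_of_le ht] at hs
      exact (S s).le_of_opNorm_le (hM s ⟨hs.1.le, hs.2⟩) v
    linarith
  exact hI.comp continuous_snd

/-- Hille's theorem for the generator and continuous integrands. -/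
theorem IsGenerator.integral (hS : IsC0Semigroup S) (hL : IsGenerator L S) {f : ℝ → H} {t : ℝ}
    (ht : 0 ≤ t) (hf : ContinuousOn f (Icc 0 t)) (hd : ∀ s ∈ Icc 0 t, f s ∈ L.domain)
    (hLf : ContinuousOn (fun s => papply L (f s)) (Icc 0 t)) :
    (∫ s in (0 : ℝ)..t, f s) ∈ L.domain ∧
      papply L (∫ s in (0 : ℝ)..t, f s) = ∫ s in (0 : ℝ)..t, papply L (f s) := by
  apply mem_domain_and_papply_eq
  -- The pair (f, L f) is a continuous curve in the graph, a closed and therefore complete subspace,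
  -- so its integral exists there. The two projections of that integral are the two integrals in
  -- question.
  have : CompleteSpace L.graph := (hL.isClosed_graph hS).completeSpace_coe
  let F : ℝ → L.graph := IccExtend ht fun s => ⟨(f s, papply L (f s)), mem_graph_papply (hd s s.2)⟩
  have hF : Continuous F := by
    refine Continuous.Icc_extend' (Continuous.subtype_mk ?_ _)
    exact (continuousOn_iff_continuous_domRestrict.1 hf).prodMk
      (continuousOn_iff_continuous_domRestrict.1 hLf)
  have hF' : ∀ s ∈ Icc 0 t, ((F s : L.graph) : H × H) = (f s, papply L (f s)) := fun s hs => by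
    simp only [F, IccExtend_of_mem ht _ hs]
  have h1 := ContinuousLinearMap.intervalIntegral_comp_comm
    ((ContinuousLinearMap.fst ℂ H H).comp L.graph.subtypeL) (hF.intervalIntegrable (μ := volume) 0 t)
  have h2 := ContinuousLinearMap.intervalIntegral_comp_comm
    ((ContinuousLinearMap.snd ℂ H H).comp L.graph.subtypeL) (hF.intervalIntegrable (μ := volume) 0 t)
  have h3 : ∫ s in (0 : ℝ)..t, f s = ((∫ s in (0 : ℝ)..t, F s : L.graph) : H × H).1 := by
    refine Eq.trans (intervalIntegral.integral_congr fun s hs => ?_) h1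
    rw [uIcc_of_le ht] at hs
    simp [hF' s hs]
  have h4 : ∫ s in (0 : ℝ)..t, papply L (f s) = ((∫ s in (0 : ℝ)..t, F s : L.graph) : H × H).2 := by
    refine Eq.trans (intervalIntegral.integral_congr fun s hs => ?_) h2
    rw [uIcc_of_le ht] at hs
    simp [hF' s hs]
  rw [h3, h4]
  exact (∫ s in (0 : ℝ)..t, F s : L.graph).2

/-! ### Convolution with the semigroup -/

theorem IsC0Semigroup.continuousOn_conv (hS : IsC0Semigroup S) {f : ℝ → H} {T : ℝ} (hT : 0 ≤ T)
    (hf : ContinuousOn f (Icc 0 T)) :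
    ContinuousOn (fun t => ∫ τ in (0 : ℝ)..t, S (t - τ) (f τ)) (Icc 0 T) := by
  have hg : Continuous (IccExtend hT (domRestrict (Icc 0 T) f)) :=
    (continuousOn_iff_continuous_domRestrict.1 hf).Icc_extend'
  -- Clamping t - τ at 0 and extending f by constants makes the integrand jointly continuous on the
  -- whole plane; nothing changes for 0 ≤ τ ≤ t ≤ T.
  have h1 : Continuous (Function.uncurry fun t τ : ℝ =>
      S (max (t - τ) 0) (IccExtend hT (domRestrict (Icc 0 T) f) τ)) := by
    rw [← continuousOn_univ]
    exact hS.continuousOn_comp (by fun_prop) (fun x _ => le_max_right _ _)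
      (hg.comp continuous_snd).continuousOn
  refine (intervalIntegral.continuous_parametric_intervalIntegral_of_continuous (μ := volume)
    (a₀ := 0) h1 continuous_id).continuousOn.congr fun t ht => ?_
  refine intervalIntegral.integral_congr fun τ hτ => ?_
  rw [uIcc_of_le ht.1] at hτ
  have hτ' : τ ∈ Icc 0 T := ⟨hτ.1, hτ.2.trans ht.2⟩
  simp only [max_eq_left (sub_nonneg.2 hτ.2), IccExtend_of_mem hT _ hτ', domRestrict_apply]

theorem IsC0Semigroup.continuousOn_conv_integrand (hS : IsC0Semigroup S) {f : ℝ → H} {T t : ℝ}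
    (ht : t ≤ T) (hf : ContinuousOn f (Icc 0 T)) :
    ContinuousOn (fun τ => S (t - τ) (f τ)) (Icc 0 t) :=
  hS.continuousOn_comp (by fun_prop) (fun _ hx => sub_nonneg.2 hx.2)
    (hf.mono (Icc_subset_Icc_right ht))

theorem IsC0Semigroup.intervalIntegrable_conv (hS : IsC0Semigroup S) {f : ℝ → H} {T t : ℝ}
    (ht : t ∈ Icc 0 T) (hf : ContinuousOn f (Icc 0 T)) :
    IntervalIntegrable (fun τ => S (t - τ) (f τ)) volume 0 t := by
  refine ContinuousOn.intervalIntegrable ?_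
  rw [uIcc_of_le ht.1]
  exact hS.continuousOn_conv_integrand ht.2 hf

/-- The derivative of `τ ↦ S (t - τ) (f τ)`. -/
theorem IsGenerator.hasDerivWithinAt_conv (hS : IsC0Semigroup S) (hL : IsGenerator L S) {f : ℝ → H}
    {f' : H} {t τ : ℝ} (hτ : τ < t) (hf : HasDerivWithinAt f f' (Ioi τ) τ) (hd : f τ ∈ L.domain) :
    HasDerivWithinAt (fun s => S (t - s) (f s)) (S (t - τ) (f' - papply L (f τ))) (Ioi τ) τ := by
  -- The quotient splits into S(t-τ-h) applied to the quotient of f, handled by joint continuity,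
  -- and the quotient of s ↦ S(t-s) on the frozen vector f τ.
  have h1 : HasDerivAt (fun s => S (t - s) (f τ)) (-S (t - τ) (papply L (f τ))) τ := by
    have := (hL.hasDerivAt hS hd (sub_pos.2 hτ)).scomp τ ((hasDerivAt_id τ).const_sub t)
    simpa [Function.comp_def] using this
  have h1' := hasDerivWithinAt_Ioi_iff_tendsto.1 (h1.hasDerivWithinAt (s := Ioi τ))
  rw [hasDerivWithinAt_Ioi_iff_tendsto] at hf ⊢
  have h0 : Tendsto (fun h : ℝ => t - (τ + h)) (𝓝[>] 0) (𝓝 (t - τ)) := by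
    have : Continuous fun h : ℝ => t - (τ + h) := by fun_prop
    simpa using (this.tendsto 0).mono_left (nhdsWithin_le_nhds (s := Ioi 0))
  have h2 := hS.tendsto (sub_pos.2 hτ).le h0
    ((h0.eventually (lt_mem_nhds (sub_pos.2 hτ))).mono fun _ h => h.le) hf
  have h3 := h2.add h1'
  rw [← sub_eq_add_neg, ← map_sub] at h3
  refine h3.congr fun h => ?_
  rw [← Complex.coe_smul, ← Complex.coe_smul, ← Complex.coe_smul, map_smul, ← smul_add, map_sub]
  congr 1
  abel

end Semigroup

end OscInt
namespace OscInt

section PartialMaps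

variable {H : Type*} [NormedAddCommGroup H] [NormedSpace ℂ H]

/-! ### Values of partially defined operators -/

theorem papply_pcomp {g f : H →ₗ.[ℂ] H} {v : H} (h : v ∈ f.domain) (h' : papply f v ∈ g.domain) :
    v ∈ (pcomp g f).domain ∧ papply (pcomp g f) v = papply g (papply f v) := by
  have hg : f ⟨v, h⟩ ∈ g.domain := papply_eq h ▸ h'
  have hm : v ∈ (pcomp g f).domain := (mem_pcomp_domain g f v).2 ⟨h, hg⟩
  refine ⟨hm, ?_⟩
  rw [papply_eq hm, pcomp_apply g f v hm h hg, papply_eq h']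
  simp only [papply_eq h]

theorem papply_add {g f : H →ₗ.[ℂ] H} {v : H} (h : v ∈ f.domain) (h' : v ∈ g.domain) :
    v ∈ (f + g).domain ∧ papply (f + g) v = papply f v + papply g v := by
  have hm : v ∈ (f + g).domain := ⟨h, h'⟩
  exact ⟨hm, by rw [papply_eq hm, papply_eq h, papply_eq h']; rfl⟩

theorem papply_sub {g f : H →ₗ.[ℂ] H} {v : H} (h : v ∈ f.domain) (h' : v ∈ g.domain) :
    v ∈ (f - g).domain ∧ papply (f - g) v = papply f v - papply g v := by
  have hm : v ∈ (f - g).domain := ⟨h, h'⟩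
  exact ⟨hm, by rw [papply_eq hm, papply_eq h, papply_eq h']; rfl⟩

theorem papply_neg {f : H →ₗ.[ℂ] H} {v : H} (h : v ∈ f.domain) :
    v ∈ (-f).domain ∧ papply (-f) v = -papply f v := by
  have hm : v ∈ (-f).domain := h
  exact ⟨hm, by rw [papply_eq hm, papply_eq h]; rfl⟩

theorem papply_smul {f : H →ₗ.[ℂ] H} {v : H} (c : ℂ) (h : v ∈ f.domain) :
    v ∈ (c • f).domain ∧ papply (c • f) v = c • papply f v := by
  have hm : v ∈ (c • f).domain := h
  exact ⟨hm, by rw [papply_eq hm, papply_eq h]; rfl⟩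

theorem papply_sum {ι : Type*} (s : Finset ι) {f : ι → H →ₗ.[ℂ] H} {v : H}
    (h : ∀ i ∈ s, v ∈ (f i).domain) :
    v ∈ (∑ i ∈ s, f i).domain ∧ papply (∑ i ∈ s, f i) v = ∑ i ∈ s, papply (f i) v := by
  classical
  induction s using Finset.induction_on with
  | empty =>
    have hm : v ∈ (0 : H →ₗ.[ℂ] H).domain := Submodule.mem_top
    simp only [Finset.sum_empty]
    exact ⟨hm, by rw [papply_eq hm]; rfl⟩
  | insert i s hi ih =>
    obtain ⟨h1, h2⟩ := ih fun j hj => h j (Finset.mem_insert_of_mem hj)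
    obtain ⟨h3, h4⟩ := papply_add (h i (Finset.mem_insert_self i s)) h1
    rw [Finset.sum_insert hi, Finset.sum_insert hi]
    exact ⟨h3, by rw [h4, h2]⟩

theorem papply_map_sub {f : H →ₗ.[ℂ] H} {v w : H} (h : v ∈ f.domain) (h' : w ∈ f.domain) :
    papply f (v - w) = papply f v - papply f w := by
  rw [papply_eq (f.domain.sub_mem h h'), papply_eq h, papply_eq h', ← f.map_sub]
  rfl

theorem mem_pid_domain (v : H) : v ∈ (pid H).domain := Submodule.mem_top

theorem papply_pid (v : H) : papply (pid H) v = v := papply_eq (mem_pid_domain v)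

theorem mem_ofBounded_domain (B : H →L[ℂ] H) (v : H) : v ∈ (ofBounded B).domain :=
  Submodule.mem_top

theorem papply_ofBounded (B : H →L[ℂ] H) (v : H) : papply (ofBounded B) v = B v :=
  papply_eq (mem_ofBounded_domain B v)

end PartialMaps

section Scale

theorem intervalIntegrable_of_continuousOn {E : Type*} [NormedAddCommGroup E] {T : ℝ}
    {u : ℝ → E} (hu : ContinuousOn u (Icc 0 T)) {t : ℝ}
    (ht : t ∈ Icc 0 T) : IntervalIntegrable u volume 0 t := by
  refine (hu.mono ?_).intervalIntegrable
  rw [uIcc_of_le ht.1]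
  exact Icc_subset_Icc_right ht.2

variable {H : Type*} [NormedAddCommGroup H] [NormedSpace ℂ H]

/-! ### Scales of regularity

`G j u` stands for: `u` is a continuous map from `[0, T]` to the `j`-th space of the scale. -/

/-- A scale of function classes on `[0, T]` on which the generator `L` has order one, and which
`B` and the semigroup respect up to level `n`. -/
structure IsRegularityScale (L : H →ₗ.[ℂ] H) (S : ℝ → H →L[ℂ] H) (B : H →L[ℂ] H) (n : ℕ) (T : ℝ)
    (G : ℕ → (ℝ → H) → Prop) : Prop where
  congr : ∀ {j u v}, EqOn u v (Icc 0 T) → G j u → G j v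
  continuousOn : ∀ {u}, G 0 u → ContinuousOn u (Icc 0 T)
  sub : ∀ {j u v}, G j u → G j v → G j fun t => u t - v t
  smul : ∀ {j u} (c : ℂ), G j u → G j fun t => c • u t
  of_succ : ∀ {j u}, G (j + 1) u → G j u
  mem_domain : ∀ {u}, G 1 u → ∀ t ∈ Icc 0 T, u t ∈ L.domain
  generator : ∀ {j u}, G (j + 1) u → G j fun t => papply L (u t)
  mul : ∀ {j u}, j ≤ n → G j u → G j fun t => B (u t)
  semigroup : ∀ {j v}, j ≤ n → G j (fun _ => v) → G j fun t => S t v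

/-- `A` maps level `j + r` of the scale to level `j` and commutes with integration in time. -/
structure HasOrder (n : ℕ) (T : ℝ) (G : ℕ → (ℝ → H) → Prop) (A : H →ₗ.[ℂ] H) (r : ℕ) : Prop where
  mem_domain : ∀ {u}, r ≤ n → G r u → ∀ t ∈ Icc 0 T, u t ∈ A.domain
  map : ∀ {j u}, j + r ≤ n → G (j + r) u → G j fun t => papply A (u t)
  integral : ∀ {u v}, r ≤ n → G r u → G r v →
    (∀ t ∈ Icc 0 T, u t - u 0 = ∫ s in (0 : ℝ)..t, v s) →
    ∀ t ∈ Icc 0 T, papply A (u t) - papply A (u 0) = ∫ s in (0 : ℝ)..t, papply A (v s)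

variable {S : ℝ → H →L[ℂ] H} {L : H →ₗ.[ℂ] H} {B : H →L[ℂ] H} {n : ℕ} {T : ℝ}
  {G : ℕ → (ℝ → H) → Prop}

namespace IsRegularityScale

theorem of_le (hG : IsRegularityScale L S B n T G) {i j : ℕ} (hij : i ≤ j) {u : ℝ → H}
    (hu : G j u) : G i u := by
  induction j, hij using Nat.le_induction with
  | base => exact hu
  | succ j _ ih => exact ih (hG.of_succ hu)

theorem continuousOn' (hG : IsRegularityScale L S B n T G) {j : ℕ} {u : ℝ → H}
    (hu : G j u) : ContinuousOn u (Icc 0 T) := hG.continuousOn (hG.of_le (Nat.zero_le j) hu)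

theorem zero (hG : IsRegularityScale L S B n T G) {j : ℕ} {u : ℝ → H} (hu : G j u) :
    G j fun _ => 0 := hG.congr (fun t _ => by simp) (hG.smul 0 hu)

theorem add (hG : IsRegularityScale L S B n T G) {j : ℕ} {u v : ℝ → H} (hu : G j u) (hv : G j v) :
    G j fun t => u t + v t :=
  hG.congr (fun t _ => by simp) (hG.sub hu (hG.smul (-1) hv))

/-- The curve `w` serves the empty sum: the axioms do not put 0 at level j unless some curve is
there. -/
theorem sum (hG : IsRegularityScale L S B n T G) {ι : Type*} (s : Finset ι) {j : ℕ} {w : ℝ → H}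
    (hw : G j w) {u : ι → ℝ → H} (hu : ∀ i ∈ s, G j (u i)) : G j fun t => ∑ i ∈ s, u i t := by
  classical
  induction s using Finset.induction_on with
  | empty => simpa using hG.zero hw
  | insert i s hi ih =>
    simp only [Finset.sum_insert hi]
    exact hG.add (hu i (Finset.mem_insert_self i s))
      (ih fun k hk => hu k (Finset.mem_insert_of_mem hk))

/-- The bound of order ω^{-d} uses the expansion with n = d, hence a scale truncated at level d. -/
theorem anti (hG : IsRegularityScale L S B n T G) {n' : ℕ} (h : n' ≤ n) :
    IsRegularityScale L S B n' T G :=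
  { hG with
    mul := fun hj hu => hG.mul (hj.trans h) hu
    semigroup := fun hj hu => hG.semigroup (hj.trans h) hu }

end IsRegularityScale

/-! ### Operators of finite order on a scale. -/

theorem HasOrder.continuousOn (hG : IsRegularityScale L S B n T G) {A : H →ₗ.[ℂ] H} {r : ℕ}
    (hA : HasOrder n T G A r) (hr : r ≤ n) {u : ℝ → H} (hu : G r u) :
    ContinuousOn (fun t => papply A (u t)) (Icc 0 T) :=
  hG.continuousOn (hA.map (by omega) (by simpa using hu))

theorem HasOrder.pid : HasOrder n T G (pid H) 0 where
  mem_domain _ _ _ _ := mem_pid_domain _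
  map _ hu := by simpa [papply_pid] using hu
  integral _ _ _ h := by simpa [papply_pid] using h

theorem HasOrder.sub (hG : IsRegularityScale L S B n T G) {A A' : H →ₗ.[ℂ] H} {r : ℕ}
    (hA : HasOrder n T G A r) (hA' : HasOrder n T G A' r) : HasOrder n T G (A - A') r where
  mem_domain hr hu t ht := (papply_sub (hA.mem_domain hr hu t ht) (hA'.mem_domain hr hu t ht)).1
  map {j u} hr hu := by
    have h := hG.of_le (Nat.le_add_left r j) hu
    exact hG.congr (fun t ht => (papply_sub (hA.mem_domain (by omega) h t ht)
      (hA'.mem_domain (by omega) h t ht)).2.symm) (hG.sub (hA.map hr hu) (hA'.map hr hu))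
  integral {u v} hr hu hv h t ht := by
    have e : ∀ {w : ℝ → H}, G r w → ∀ s ∈ Icc 0 T,
        papply (A - A') (w s) = papply A (w s) - papply A' (w s) := fun hw s hs =>
      (papply_sub (hA.mem_domain hr hw s hs) (hA'.mem_domain hr hw s hs)).2
    rw [e hu t ht, e hu 0 ⟨le_rfl, ht.1.trans ht.2⟩,
      intervalIntegral.integral_congr (g := fun s => papply A (v s) - papply A' (v s)),
      intervalIntegral.integral_sub, ← hA.integral hr hu hv h t ht, ← hA'.integral hr hu hv h t ht]
    · abel
    · exact intervalIntegrable_of_continuousOn (hA.continuousOn hG hr hv) ht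
    · exact intervalIntegrable_of_continuousOn (hA'.continuousOn hG hr hv) ht
    · intro s hs
      rw [uIcc_of_le ht.1] at hs
      exact e hv s ⟨hs.1, hs.2.trans ht.2⟩

/-- Orders add: A' leaves r levels, exactly what A consumes. The integral identity is transported
first through A', then through A. -/
theorem HasOrder.pcomp (hG : IsRegularityScale L S B n T G) {A A' : H →ₗ.[ℂ] H} {r r' : ℕ}
    (hA : HasOrder n T G A r) (hA' : HasOrder n T G A' r') :
    HasOrder n T G (pcomp A A') (r + r') := by
  have hd : ∀ {u}, r + r' ≤ n → G (r + r') u → ∀ t ∈ Icc 0 T,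
      u t ∈ A'.domain ∧ papply A' (u t) ∈ A.domain := fun hr hu t ht =>
    ⟨hA'.mem_domain (by omega) (hG.of_le (Nat.le_add_left _ _) hu) t ht,
      hA.mem_domain (by omega) (hA'.map hr hu) t ht⟩
  refine ⟨fun hr hu t ht => (papply_pcomp (hd hr hu t ht).1 (hd hr hu t ht).2).1,
    fun {j u} hr hu => ?_, fun {u v} hr hu hv h t ht => ?_⟩
  · have hu' := hG.of_le (Nat.le_add_left (r + r') j) hu
    rw [← add_assoc] at hr hu
    refine hG.congr (fun t ht => ?_) (hA.map (by omega) (hA'.map hr hu))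
    obtain ⟨h1, h2⟩ := hd (by omega) hu' t ht
    exact (papply_pcomp h1 h2).2.symm
  · have e : ∀ {w : ℝ → H}, G (r + r') w → ∀ s ∈ Icc 0 T,
        papply (OscInt.pcomp A A') (w s) = papply A (papply A' (w s)) := fun hw s hs =>
      (papply_pcomp (hd hr hw s hs).1 (hd hr hw s hs).2).2
    rw [e hu t ht, e hu 0 ⟨le_rfl, ht.1.trans ht.2⟩, hA.integral (by omega) (hA'.map hr hu)
      (hA'.map hr hv) (hA'.integral (by omega) (hG.of_le (Nat.le_add_left _ _) hu)
        (hG.of_le (Nat.le_add_left _ _) hv) h) t ht]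
    refine intervalIntegral.integral_congr fun s hs => ?_
    rw [uIcc_of_le ht.1] at hs
    exact (e hv s ⟨hs.1, hs.2.trans ht.2⟩).symm

variable [CompleteSpace H]

/-- Compatibility with time integrals is Hille's theorem, since both u and L u are continuous curves
when u has level one. -/
theorem HasOrder.generator (hS : IsC0Semigroup S) (hL : IsGenerator L S)
    (hG : IsRegularityScale L S B n T G) : HasOrder n T G L 1 where
  mem_domain _ hu := hG.mem_domain hu
  map _ hu := hG.generator hu
  integral {u v} hr hu hv h t ht := by
    rw [← papply_map_sub (hG.mem_domain hu t ht) (hG.mem_domain hu 0 ⟨le_rfl, ht.1.trans ht.2⟩),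
      h t ht]
    have hs : Icc 0 t ⊆ Icc 0 T := Icc_subset_Icc_right ht.2
    exact (hL.integral hS ht.1 ((hG.continuousOn' hv).mono hs)
      (fun s hs' => hG.mem_domain hv s (hs hs')) ((hG.continuousOn (hG.generator hv)).mono hs)).2

theorem HasOrder.ofBounded (hG : IsRegularityScale L S B n T G) :
    HasOrder n T G (ofBounded B) 0 where
  mem_domain _ _ _ _ := mem_ofBounded_domain _ _
  map hr hu := by simpa [papply_ofBounded] using hG.mul hr hu
  integral {u v} hr hu hv h t ht := by
    simp only [papply_ofBounded]
    rw [B.intervalIntegral_comp_comm (intervalIntegrable_of_continuousOn (hG.continuousOn hv) ht),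
      ← map_sub, h t ht]

/-- Each commutator is charged one full order, that of L composed with the previous operator on
either side; no cancellation of leading parts is used. -/
theorem HasOrder.adPow (hS : IsC0Semigroup S) (hL : IsGenerator L S)
    (hG : IsRegularityScale L S B n T G) {A : H →ₗ.[ℂ] H} {r : ℕ} (hA : HasOrder n T G A r)
    (k : ℕ) : HasOrder n T G (adPow L A k) (r + k) := by
  induction k with
  | zero => exact hA
  | succ k ih =>
    have h1 := (HasOrder.generator hS hL hG).pcomp hG ih
    rw [add_comm] at h1
    exact h1.sub hG (ih.pcomp hG (HasOrder.generator hS hL hG))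

/-- Multiplication by α costs nothing, so the order is just the total number of commutators taken.
-/
theorem HasOrder.opN (hS : IsC0Semigroup S) (hL : IsGenerator L S)
    (hG : IsRegularityScale L S B n T G) (k : ℕ → ℕ) (l r : ℕ) :
    HasOrder n T G (opN L B k (l + 1) r) (∑ i ∈ Finset.Icc (l + 1) r, k i) := by
  induction r with
  | zero => simpa [OscInt.opN] using HasOrder.pid
  | succ r ih =>
    rw [OscInt.opN]
    split_ifs with h
    · rw [Finset.Icc_eq_empty (by omega), Finset.sum_empty]
      exact HasOrder.pid
    · rw [Finset.sum_Icc_succ_top (by omega)]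
      refine HasOrder.adPow hS hL hG ?_ _
      simpa using (HasOrder.ofBounded hG).pcomp hG ih

theorem sum_Icc_add_sum_Icc (k : ℕ → ℕ) {l r : ℕ} (h : l ≤ r) :
    ∑ i ∈ Finset.Icc 1 l, k i + ∑ i ∈ Finset.Icc (l + 1) r, k i = ∑ i ∈ Finset.Icc 1 r, k i := by
  have := Finset.sum_Ioc_consecutive k (Nat.zero_le l) h
  simpa [← Finset.Icc_add_one_left_eq_Ioc] using this

/-- The vectors `F_l v`: domain, value and regularity. -/
theorem opF_spec (hS : IsC0Semigroup S) (hL : IsGenerator L S)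
    (hG : IsRegularityScale L S B n T G) (hT : 0 ≤ T) (k : ℕ → ℕ) (l : ℕ) {j : ℕ} {v : H}
    (hj : j + ∑ i ∈ Finset.Icc 1 l, k i ≤ n)
    (hv : G (j + ∑ i ∈ Finset.Icc 1 l, k i) fun _ => v) :
    v ∈ (opF L B k l).domain ∧ G j (fun _ => papply (opF L B k l) v) ∧
      (1 ≤ l → papply (opF L B k l) v = -∑ m ∈ Finset.range l, ((coefA k l (l - m) : ℚ) : ℂ) •
        papply (opN L B k (m + 1) l) (papply (opF L B k m) v)) := by
  induction l using Nat.strong_induction_on generalizing j with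
  | _ l ih =>
  obtain _ | l := l
  · rw [opF, papply_pid]
    exact ⟨mem_pid_domain v, by simpa using hv, by simp⟩
  · have h0 : (0 : ℝ) ∈ Icc 0 T := ⟨le_rfl, hT⟩
    have key : ∀ m ≤ l, v ∈ (pcomp (opN L B k (m + 1) (l + 1)) (opF L B k m)).domain ∧
        papply (pcomp (opN L B k (m + 1) (l + 1)) (opF L B k m)) v =
          papply (opN L B k (m + 1) (l + 1)) (papply (opF L B k m) v) ∧
        G j (fun _ => papply (opN L B k (m + 1) (l + 1)) (papply (opF L B k m) v)) := by
      intro m hm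
      -- The levels spent by F_m and by N_{k_{m+1}}^{k_{l+1}} add up to k_1 + … + k_{l+1} for every
      -- m, so all summands of F_{l+1} end at the same level j.
      have e := sum_Icc_add_sum_Icc k (l := m) (r := l + 1) (by omega)
      have e' : j + ∑ i ∈ Finset.Icc 1 (l + 1), k i =
          (j + ∑ i ∈ Finset.Icc (m + 1) (l + 1), k i) + ∑ i ∈ Finset.Icc 1 m, k i := by omega
      rw [e'] at hj hv
      obtain ⟨h1, h2, -⟩ := ih m (by omega) hj hv
      have hN := HasOrder.opN hS hL hG k m (l + 1)
      obtain ⟨h3, h4⟩ := papply_pcomp h1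
        (hN.mem_domain (by omega) (hG.of_le (Nat.le_add_left _ j) h2) 0 h0)
      exact ⟨h3, h4, hN.map (by omega) h2⟩
    have h1 := papply_sum Finset.univ (v := v) (f := fun m : Fin (l + 1) =>
      ((coefA k (l + 1) (l + 1 - m) : ℚ) : ℂ) • pcomp (opN L B k (m + 1) (l + 1)) (opF L B k m))
      fun m _ => (papply_smul _ (key m (by omega)).1).1
    obtain ⟨h2, h3⟩ := papply_neg h1.1
    have e : papply (opF L B k (l + 1)) v =
        -∑ m ∈ Finset.range (l + 1), ((coefA k (l + 1) (l + 1 - m) : ℚ) : ℂ) •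
          papply (opN L B k (m + 1) (l + 1)) (papply (opF L B k m) v) := by
      rw [opF, h3, h1.2, Finset.sum_range]
      congr 1
      refine Finset.sum_congr rfl fun m _ => ?_
      obtain ⟨h4, h5, -⟩ := key m (by omega)
      rw [(papply_smul _ h4).2, h5]
    refine ⟨by rw [opF]; exact h2, ?_, fun _ => e⟩
    rw [e]
    have h6 := hG.smul (-1) (hG.sum (Finset.range (l + 1))
      (key l le_rfl).2.2 (u := fun m _ => ((coefA k (l + 1) (l + 1 - m) : ℚ) : ℂ) •
          papply (opN L B k (m + 1) (l + 1)) (papply (opF L B k m) v))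
      fun m hm => hG.smul _ (key m (by simpa [Nat.lt_succ_iff] using hm)).2.2)
    simpa using h6

/-! ### Oscillatory integrals along the semigroup. -/

/-- Integration by parts in an oscillatory integral along the semigroup. -/
theorem HasOrder.integral_exp_smul (hS : IsC0Semigroup S) (hL : IsGenerator L S)
    (hG : IsRegularityScale L S B n T G) {A : H →ₗ.[ℂ] H} {r : ℕ} (hA : HasOrder n T G A r)
    (hr : r + 1 ≤ n) {w : H} (hw : G (r + 1) fun _ => w) {c : ℂ} (hc : c ≠ 0) {t : ℝ}
    (ht : t ∈ Icc 0 T) :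
    ∫ τ in (0 : ℝ)..t, Complex.exp (c * τ) • S (t - τ) (papply A (S τ w)) =
      c⁻¹ • (Complex.exp (c * t) • papply A (S t w) - S t (papply A w)) +
      c⁻¹ • ∫ τ in (0 : ℝ)..t,
        Complex.exp (c * τ) • S (t - τ) (papply (OscInt.adPow L A 1) (S τ w)) := by
  have hT0 : (0 : ℝ) ∈ Icc 0 T := ⟨le_rfl, ht.1.trans ht.2⟩
  have hwL : w ∈ L.domain := hG.mem_domain (hG.of_le (by omega) hw) 0 hT0
  have hu : G (r + 1) fun τ => S τ w := hG.semigroup hr hw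
  have hu1 : G r fun τ => S τ w := hG.of_succ hu
  have hv : G r fun τ => S τ (papply L w) := hG.semigroup (by omega) (hG.generator hw)
  have hAu : ContinuousOn (fun τ => papply A (S τ w)) (Icc 0 T) :=
    hA.continuousOn hG (by omega) hu1
  have hAv : ContinuousOn (fun τ => papply A (S τ (papply L w))) (Icc 0 T) :=
    hA.continuousOn hG (by omega) hv
  have hAu' : G 1 fun τ => papply A (S τ w) := hA.map (by omega) (by rwa [add_comm])
  have hLA : ContinuousOn (fun τ => papply L (papply A (S τ w))) (Icc 0 T) :=
    hG.continuousOn (hG.generator hAu')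
  -- The identity S τ w - w = ∫ S s (L w) ds is passed through A. This replaces closedness of A and
  -- yields the derivative of τ ↦ A S(τ) w.
  have hint := hA.integral (by omega) hu1 hv fun s hs => by
    simpa [hS.zero] using hL.sub_eq_integral hS hwL hs.1
  have hder : ∀ τ ∈ Ioo 0 T, HasDerivAt (fun τ => papply A (S τ w))
      (papply A (S τ (papply L w))) τ := by
    intro τ hτ
    refine ((hasDerivAt_integral_of_continuousOn hAv hτ).add_const
      (papply A (S 0 w))).congr_of_eventuallyEq ?_
    filter_upwards [Icc_mem_nhds hτ.1 hτ.2] with s hs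
    rw [← hint s hs, sub_add_cancel]
  have hcomm : ∀ τ ∈ Icc 0 T, papply (OscInt.adPow L A 1) (S τ w) =
      papply L (papply A (S τ w)) - papply A (S τ (papply L w)) := by
    intro τ hτ
    obtain ⟨h1, h2⟩ := hL.map hS hwL hτ.1
    obtain ⟨h3, h4⟩ := papply_pcomp (hA.mem_domain (by omega) hu1 τ hτ)
      (hG.mem_domain hAu' τ hτ)
    obtain ⟨h5, h6⟩ := papply_pcomp (g := A) h1 (by
      rw [h2]; exact hA.mem_domain (by omega) hv τ hτ)
    exact (papply_sub h3 h5).2.trans (by rw [h4, h6, h2])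
  have hexp : Continuous fun τ : ℝ => Complex.exp (c * τ) := by fun_prop
  have hc1 : ContinuousOn (fun τ : ℝ => Complex.exp (c * τ) • S (t - τ) (papply A (S τ w)))
      (Icc 0 t) := hexp.continuousOn.smul (hS.continuousOn_conv_integrand ht.2 hAu)
  have hc2 : ContinuousOn (fun τ : ℝ => Complex.exp (c * τ) •
      S (t - τ) (papply (OscInt.adPow L A 1) (S τ w))) (Icc 0 t) :=
    hexp.continuousOn.smul (hS.continuousOn_conv_integrand ht.2
      ((hLA.sub hAv).congr hcomm))
  -- The derivative of e^{cτ} S(t-τ) A S(τ) w is c times itself minus the commutator term. Its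
  -- integral is the difference of the boundary values, and this is solved for the original
  -- integral.
  have ftc := intervalIntegral.integral_eq_sub_of_hasDeriv_right
    (f := fun τ : ℝ => Complex.exp (c * τ) • S (t - τ) (papply A (S τ w)))
    (f' := fun τ : ℝ => c • (Complex.exp (c * τ) • S (t - τ) (papply A (S τ w))) -
      Complex.exp (c * τ) • S (t - τ) (papply (OscInt.adPow L A 1) (S τ w)))
    (a := 0) (b := t) (by rwa [uIcc_of_le ht.1]) ?_ ?_
  · rw [intervalIntegral.integral_sub, intervalIntegral.integral_smul] at ftc
    · simp only [sub_self, hS.zero, sub_zero, Complex.ofReal_zero, mul_zero, Complex.exp_zero,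
        one_smul, ContinuousLinearMap.id_apply] at ftc
      rw [← smul_add, ← ftc, sub_add_cancel, smul_smul, inv_mul_cancel₀ hc, one_smul]
    · exact intervalIntegrable_of_continuousOn (hc1.const_smul c) ⟨ht.1, le_rfl⟩
    · exact intervalIntegrable_of_continuousOn hc2 ⟨ht.1, le_rfl⟩
  · intro τ hτ
    rw [min_eq_left ht.1, max_eq_right ht.1] at hτ
    have hτ' : τ ∈ Ioo 0 T := ⟨hτ.1, hτ.2.trans_le ht.2⟩
    have d1 := hL.hasDerivWithinAt_conv hS hτ.2 (hder τ hτ').hasDerivWithinAt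
      (hG.mem_domain hAu' τ (Ioo_subset_Icc_self hτ'))
    have d2 : HasDerivAt (fun τ : ℝ => Complex.exp (c * τ)) (Complex.exp (c * τ) * c) τ := by
      simpa using ((hasDerivAt_id (τ : ℂ)).const_mul c).cexp.comp_ofReal
    refine (d2.hasDerivWithinAt.smul d1).congr_deriv ?_
    rw [hcomm τ (Ioo_subset_Icc_self hτ'), ← neg_sub (papply L _), map_neg, smul_neg, smul_smul,
      mul_comm c (Complex.exp _)]
    abel
  · exact intervalIntegrable_of_continuousOn ((hc1.const_smul c).sub hc2) ⟨ht.1, le_rfl⟩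

/-- The basic step is applied in turn to A, ad_L(A), ad_L²(A), …; it closes up because one
commutator of ad_L^K(A) is ad_L^{K+1}(A) by definition. Each step uses up one level of w. -/
theorem HasOrder.integral_exp_smul_iterate (hS : IsC0Semigroup S) (hL : IsGenerator L S)
    (hG : IsRegularityScale L S B n T G) {A : H →ₗ.[ℂ] H} {r : ℕ} (hA : HasOrder n T G A r)
    (K : ℕ) (hr : r + K ≤ n) {w : H} (hw : G (r + K) fun _ => w) {c : ℂ} (hc : c ≠ 0) {t : ℝ}
    (ht : t ∈ Icc 0 T) :
    ∫ τ in (0 : ℝ)..t, Complex.exp (c * τ) • S (t - τ) (papply A (S τ w)) =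
      ∑ j ∈ Finset.range K, (c ^ (j + 1))⁻¹ •
        (Complex.exp (c * t) • papply (OscInt.adPow L A j) (S t w) -
          S t (papply (OscInt.adPow L A j) w)) +
      (c ^ K)⁻¹ • ∫ τ in (0 : ℝ)..t,
        Complex.exp (c * τ) • S (t - τ) (papply (OscInt.adPow L A K) (S τ w)) := by
  induction K with
  | zero => simp [OscInt.adPow]
  | succ K ih =>
    rw [ih (by omega) (hG.of_succ hw), Finset.sum_range_succ, add_assoc,
      (hA.adPow hS hL hG K).integral_exp_smul hS hL hG hr hw hc ht, smul_add, smul_smul, smul_smul,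
      ← mul_inv, ← pow_succ]
    rfl

end Scale

end OscInt
namespace OscInt

section Combinatorics

/-! ### Multi-indices and coefficients -/

theorem sum_piAntidiag_Icc_succ {M : Type*} [AddCommMonoid M] (d s : ℕ) (f : (ℕ → ℕ) → M) :
    ∑ k ∈ Finset.piAntidiag (Finset.Icc 1 (d + 1)) s, f k =
      ∑ p ∈ Finset.HasAntidiagonal.antidiagonal s, ∑ k ∈ Finset.piAntidiag (Finset.Icc 1 d) p.2,
        f (Function.update k (d + 1) p.1) := by
  have hi : d + 1 ∉ Finset.Icc 1 d := by simp
  have e : Finset.Icc 1 (d + 1) = Finset.cons (d + 1) (Finset.Icc 1 d) hi := by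
    ext i; simp; omega
  rw [e, Finset.piAntidiag_cons, Finset.sum_disjiUnion]
  refine Finset.sum_congr rfl fun p _ => ?_
  rw [Finset.sum_map]
  refine Finset.sum_congr rfl fun k hk => ?_
  congr 1
  -- A multi-index vanishes off 1, …, d, so adding the last entry and overwriting it are the same.
  have hk0 : k (d + 1) = 0 := by
    by_contra h
    exact hi ((Finset.mem_piAntidiag.1 hk).2 _ h)
  funext t
  by_cases ht : t = d + 1
  · subst ht; simp [hk0]
  · simp [ht]

/-- Both sides run over the pairs with j + s < N. The extra row s = N on the right is empty; it is
kept because the corresponding multi-indices of depth d do contribute to the remainder. -/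
theorem sum_range_sum_antidiagonal {M : Type*} [AddCommMonoid M] (N : ℕ) (g : ℕ → ℕ → M) :
    ∑ s ∈ Finset.range N, ∑ p ∈ Finset.HasAntidiagonal.antidiagonal s, g p.1 p.2 =
      ∑ s ∈ Finset.range (N + 1), ∑ j ∈ Finset.range (N - s), g j s := by
  rw [Finset.sum_sigma', Finset.sum_sigma']
  refine Finset.sum_bij' (fun x _ => ⟨x.2.2, x.2.1⟩) (fun x _ => ⟨x.2 + x.1, (x.2, x.1)⟩)
    ?_ ?_ ?_ ?_ ?_
  · rintro ⟨s, p⟩ h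
    simp only [Finset.mem_sigma, Finset.mem_range, Finset.HasAntidiagonal.mem_antidiagonal] at h ⊢
    omega
  · rintro ⟨s, j⟩ h
    simp only [Finset.mem_sigma, Finset.mem_range] at h
    exact Finset.mem_sigma.2 ⟨Finset.mem_range.2 (show j + s < N by omega),
      Finset.HasAntidiagonal.mem_antidiagonal.2 rfl⟩
  · rintro ⟨s, p⟩ h
    simp only [Finset.mem_sigma, Finset.mem_range, Finset.HasAntidiagonal.mem_antidiagonal] at h
    obtain ⟨_, rfl⟩ := h
    rfl
  · rintro ⟨s, j⟩ _
    rfl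
  · rintro ⟨s, p⟩ _
    rfl

/-- Groups the multi-indices of length d+1 by their first d entries. The bound N - s on the last
entry becomes the number of integrations by parts applied to a term with |k| = s. -/
theorem sum_piAntidiag_triangle {M : Type*} [AddCommMonoid M] (d N : ℕ)
    (f : ℕ → (ℕ → ℕ) → M) :
    ∑ s ∈ Finset.range N, ∑ k ∈ Finset.piAntidiag (Finset.Icc 1 (d + 1)) s, f s k =
      ∑ s ∈ Finset.range (N + 1), ∑ k ∈ Finset.piAntidiag (Finset.Icc 1 d) s,
        ∑ j ∈ Finset.range (N - s), f (s + j) (Function.update k (d + 1) j) := by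
  rw [Finset.sum_congr rfl fun s _ => sum_piAntidiag_Icc_succ d s (f s)]
  have h : ∀ s ∈ Finset.range N, ∑ p ∈ Finset.HasAntidiagonal.antidiagonal s,
      ∑ k ∈ Finset.piAntidiag (Finset.Icc 1 d) p.2, f s (Function.update k (d + 1) p.1) =
      ∑ p ∈ Finset.HasAntidiagonal.antidiagonal s,
      ∑ k ∈ Finset.piAntidiag (Finset.Icc 1 d) p.2,
        f (p.2 + p.1) (Function.update k (d + 1) p.1) := fun s _ =>
    Finset.sum_congr rfl fun p hp => by
      rw [add_comm p.2 p.1, Finset.HasAntidiagonal.mem_antidiagonal.1 hp]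
  rw [Finset.sum_congr rfl h, sum_range_sum_antidiagonal N fun j s => ∑ k ∈ Finset.piAntidiag (Finset.Icc 1 d) s,
      f (s + j) (Function.update k (d + 1) j)]
  exact Finset.sum_congr rfl fun s _ => Finset.sum_comm

/-- The companion for the remainder: once |k| is prescribed, the first d entries determine the last
one. -/
theorem sum_piAntidiag_diagonal {M : Type*} [AddCommMonoid M] (d N : ℕ) (f : (ℕ → ℕ) → M) :
    ∑ k ∈ Finset.piAntidiag (Finset.Icc 1 (d + 1)) N, f k =
      ∑ s ∈ Finset.range (N + 1), ∑ k ∈ Finset.piAntidiag (Finset.Icc 1 d) s,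
        f (Function.update k (d + 1) (N - s)) := by
  rw [sum_piAntidiag_Icc_succ, ← Finset.Nat.sum_antidiagonal_swap,
    Finset.Nat.sum_antidiagonal_eq_sum_range_succ_mk]
  rfl

theorem sum_Icc_of_mem_piAntidiag {d s : ℕ} {k : ℕ → ℕ}
    (hk : k ∈ Finset.piAntidiag (Finset.Icc 1 d) s) : ∑ i ∈ Finset.Icc 1 d, k i = s :=
  (Finset.mem_piAntidiag.1 hk).1

theorem sum_Icc_update {d : ℕ} (k : ℕ → ℕ) (j : ℕ) :
    ∑ i ∈ Finset.Icc 1 (d + 1), Function.update k (d + 1) j i =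
      ∑ i ∈ Finset.Icc 1 d, k i + j := by
  rw [Finset.sum_Icc_succ_top (by omega), Function.update_self]
  congr 1
  refine Finset.sum_congr rfl fun i hi => Function.update_of_ne ?_ _ _
  have := (Finset.mem_Icc.1 hi).2
  omega

theorem coefA_zero (k : ℕ → ℕ) (l : ℕ) : coefA k l 0 = 1 := by simp [coefA]

/-- The new factor is the numerical part of c^{-(j+1)} for c = (q+1) iω, the weight of the boundary
term with j commutators. -/
theorem coefA_update (k : ℕ → ℕ) (d j q : ℕ) :
    coefA (Function.update k (d + 1) j) (d + 1) (q + 1) =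
      (((q + 1 : ℕ) : ℚ) ^ (j + 1))⁻¹ * coefA k d q := by
  have e : ∀ r ∈ Finset.range q, (((q + 1 - (r + 1) : ℕ) : ℚ) ^
      (Function.update k (d + 1) j (d + 1 - (r + 1)) + 1)) =
      ((q - r : ℕ) : ℚ) ^ (k (d - r) + 1) := fun r _ => by
    rw [Nat.add_sub_add_right, Nat.add_sub_add_right, Function.update_of_ne (by omega)]
  rw [coefA, coefA, Finset.prod_range_succ', Finset.prod_congr rfl e]
  simp [mul_comm]

/-- The integral left after j integrations by parts carries c^{-j} rather than c^{-(j+1)}; this is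
the only difference between b and a. -/
theorem coefB_update (k : ℕ → ℕ) (d j q : ℕ) :
    coefB (Function.update k (d + 1) j) (d + 1) (q + 1) =
      (((q + 1 : ℕ) : ℚ) ^ j)⁻¹ * coefA k d q := by
  have e : ∀ r ∈ Finset.range q, (((q + 1 - (1 + r) : ℕ) : ℚ) ^
      (Function.update k (d + 1) j (d + 1 - (1 + r)) + 1)) =
      ((q - r : ℕ) : ℚ) ^ (k (d - r) + 1) := fun r _ => by
    rw [add_comm 1 r, Nat.add_sub_add_right, Nat.add_sub_add_right,
      Function.update_of_ne (by omega)]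
  rw [coefB, if_neg (Nat.succ_ne_zero q), coefA, Finset.prod_Ico_eq_prod_range,
    Nat.add_sub_cancel, Finset.prod_congr rfl e, Function.update_self]
  simp [mul_comm]

variable {H : Type*} [NormedAddCommGroup H] [NormedSpace ℂ H]

theorem opN_congr (L : H →ₗ.[ℂ] H) (B : H →L[ℂ] H) {k k' : ℕ → ℕ} (l : ℕ) {r : ℕ}
    (h : ∀ i ≤ r, k i = k' i) : opN L B k l r = opN L B k' l r := by
  induction r with
  | zero => rfl
  | succ r ih => rw [opN, opN, ih fun i hi => h i (by omega), h (r + 1) le_rfl]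

theorem coefA_congr {k k' : ℕ → ℕ} {l : ℕ} (j : ℕ) (h : ∀ i ≤ l, k i = k' i) :
    coefA k l j = coefA k' l j := by
  rw [coefA, coefA, Finset.prod_congr rfl fun r _ => by rw [h (l - r) (Nat.sub_le l r)]]

theorem opF_congr (L : H →ₗ.[ℂ] H) (B : H →L[ℂ] H) {k k' : ℕ → ℕ} {l : ℕ}
    (h : ∀ i ≤ l, k i = k' i) : opF L B k l = opF L B k' l := by
  induction l using Nat.strong_induction_on with
  | _ l ih =>
  obtain _ | l := l
  · rw [opF, opF]
  · rw [opF, opF]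
    congr 1
    refine Finset.sum_congr rfl fun m _ => ?_
    rw [coefA_congr _ h, opN_congr L B _ h, ih m m.2 fun i hi => h i (by omega)]

/-- This makes the family of operators N stable under integration by parts: j commutators of α N
with L just append the entry j to k. The companion `opF_update` says that F_l, for l ≤ d, does not
see the new entry. -/
theorem opN_update (L : H →ₗ.[ℂ] H) (B : H →L[ℂ] H) (k : ℕ → ℕ) {l d : ℕ} (h : l ≤ d) (j : ℕ) :
    opN L B (Function.update k (d + 1) j) (l + 1) (d + 1) =
      adPow L (pcomp (ofBounded B) (opN L B k (l + 1) d)) j := by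
  rw [opN, if_neg (by omega), Function.update_self, opN_congr L B (l + 1) (k' := k)]
  exact fun i hi => Function.update_of_ne (by omega) _ _

theorem opF_update (L : H →ₗ.[ℂ] H) (B : H →L[ℂ] H) (k : ℕ → ℕ) {l d : ℕ} (h : l ≤ d) (j : ℕ) :
    opF L B (Function.update k (d + 1) j) l = opF L B k l :=
  opF_congr L B fun i hi => Function.update_of_ne (by omega) _ _

theorem opN_of_lt (L : H →ₗ.[ℂ] H) (B : H →L[ℂ] H) (k : ℕ → ℕ) {l r : ℕ} (h : r < l) :
    opN L B k l r = pid H := by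
  cases r with
  | zero => rfl
  | succ r => rw [opN, if_pos h]

end Combinatorics

/-! ### The asymptotic expansion of the nested integrals. -/

section Expansion

variable {H : Type*} [NormedAddCommGroup H] [NormedSpace ℂ H] {S : ℝ → H →L[ℂ] H}
  {L : H →ₗ.[ℂ] H} {B : H →L[ℂ] H} {n : ℕ} {T : ℝ} {G : ℕ → (ℝ → H) → Prop}

/-- The vector `N_{k_{l+1}}^{k_d} e^{tL} F_l u₀`. -/
def expTerm (L : H →ₗ.[ℂ] H) (S : ℝ → H →L[ℂ] H) (B : H →L[ℂ] H) (u₀ : H) (k : ℕ → ℕ) (d l : ℕ)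
    (t : ℝ) : H :=
  papply (opN L B k (l + 1) d) (S t (papply (opF L B k l) u₀))

/-- The Duhamel integral `∫_0^t e^{(t-τ)L} B e^{iωτ} f(τ) dτ`. -/
def duhamel (S : ℝ → H →L[ℂ] H) (B : H →L[ℂ] H) (ω : ℝ) (f : ℝ → H) (t : ℝ) : H :=
  ∫ τ in (0 : ℝ)..t, S (t - τ) (B (Complex.exp (Complex.I * ω * τ) • f τ))

theorem seriesS_eq (L : H →ₗ.[ℂ] H) (S : ℝ → H →L[ℂ] H) (B : H →L[ℂ] H) (ω : ℝ) (u₀ : H)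
    (n d : ℕ) (t : ℝ) :
    seriesS L S B ω u₀ n d t = ∑ s ∈ Finset.range (n - d + 1),
      ∑ k ∈ Finset.piAntidiag (Finset.Icc 1 d) s,
        (1 / (Complex.I * ω) ^ (d + s)) • ∑ l ∈ Finset.range (d + 1),
          (((coefA k d (d - l) : ℚ) : ℂ) *
            Complex.exp (((d - l : ℕ) : ℂ) * Complex.I * ω * t)) •
            expTerm L S B u₀ k d l t := rfl

theorem remE_succ (L : H →ₗ.[ℂ] H) (S : ℝ → H →L[ℂ] H) (B : H →L[ℂ] H) (ω : ℝ) (u₀ : H)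
    (n d : ℕ) (t : ℝ) :
    remE L S B ω u₀ n (d + 1) t = (1 / (Complex.I * ω) ^ n) •
      (∑ k ∈ Finset.piAntidiag (Finset.Icc 1 (d + 1)) (n - (d + 1) + 1),
        ∑ l ∈ Finset.range (d + 1), ((coefB k (d + 1) (d + 1 - l) : ℚ) : ℂ) •
          ∫ τ in (0 : ℝ)..t, Complex.exp (((d + 1 - l : ℕ) : ℂ) * Complex.I * ω * τ) •
            S (t - τ) (expTerm L S B u₀ k (d + 1) l τ)) +
      duhamel S B ω (remE L S B ω u₀ n d) t := rfl

theorem duhamel_congr {ω t : ℝ} (ht : 0 ≤ t) {f g : ℝ → H} (h : EqOn f g (Icc 0 t)) :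
    duhamel S B ω f t = duhamel S B ω g t := by
  refine intervalIntegral.integral_congr fun τ hτ => ?_
  rw [uIcc_of_le ht] at hτ
  simp only [h hτ]

theorem duhamel_smul (ω t : ℝ) (c : ℂ) (f : ℝ → H) :
    duhamel S B ω (fun τ => c • f τ) t = c • duhamel S B ω f t := by
  simp only [duhamel, smul_comm _ c, map_smul]
  exact intervalIntegral.integral_smul c _

theorem norm_duhamel_le {ω t M C : ℝ} (hM : ∀ s ∈ Icc 0 T, ‖S s‖ ≤ M) (ht : t ∈ Icc 0 T)
    {f : ℝ → H} (hf : ∀ τ ∈ Icc 0 T, ‖f τ‖ ≤ C) : ‖duhamel S B ω f t‖ ≤ M * (‖B‖ * C) * T := by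
  have hM0 : 0 ≤ M := (norm_nonneg _).trans (hM t ht)
  have hC0 : 0 ≤ C := (norm_nonneg _).trans (hf t ht)
  have h : ‖duhamel S B ω f t‖ ≤ M * (‖B‖ * C) * |t - 0| := by
    refine intervalIntegral.norm_integral_le_of_norm_le_const fun τ hτ => ?_
    rw [uIoc_of_le ht.1] at hτ
    have he : ‖Complex.exp (Complex.I * ω * τ)‖ = 1 := by
      rw [mul_assoc, mul_comm, ← Complex.ofReal_mul, Complex.norm_exp_ofReal_mul_I]
    refine (S (t - τ)).le_of_opNorm_le_of_le
      (hM _ ⟨sub_nonneg.2 hτ.2, by linarith [ht.2, hτ.1]⟩) (B.le_of_opNorm_le_of_le le_rfl ?_)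
    rw [norm_smul, he, one_mul]
    exact hf τ ⟨hτ.1.le, hτ.2.trans ht.2⟩
  rw [sub_zero, abs_of_nonneg ht.1] at h
  exact h.trans (mul_le_mul_of_nonneg_left ht.2 (by positivity))

theorem continuousOn_duhamel_integrand {ω : ℝ} {f : ℝ → H} (hf : ContinuousOn f (Icc 0 T)) :
    ContinuousOn (fun τ : ℝ => B (Complex.exp (Complex.I * ω * τ) • f τ)) (Icc 0 T) := by
  have h : Continuous fun τ : ℝ => Complex.exp (Complex.I * ω * τ) := by fun_prop
  exact B.continuous.comp_continuousOn (h.continuousOn.smul hf)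

variable [CompleteSpace H]

theorem continuousOn_duhamel (hS : IsC0Semigroup S) (hT : 0 ≤ T) (ω : ℝ) {f : ℝ → H}
    (hf : ContinuousOn f (Icc 0 T)) : ContinuousOn (duhamel S B ω f) (Icc 0 T) :=
  hS.continuousOn_conv hT (continuousOn_duhamel_integrand hf)

theorem duhamel_add (hS : IsC0Semigroup S) {ω t : ℝ} (ht : t ∈ Icc 0 T) {f g : ℝ → H}
    (hf : ContinuousOn f (Icc 0 T)) (hg : ContinuousOn g (Icc 0 T)) :
    duhamel S B ω (fun τ => f τ + g τ) t = duhamel S B ω f t + duhamel S B ω g t := by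
  simp only [duhamel, smul_add, map_add]
  exact intervalIntegral.integral_add
    (hS.intervalIntegrable_conv ht (continuousOn_duhamel_integrand hf))
    (hS.intervalIntegrable_conv ht (continuousOn_duhamel_integrand hg))

theorem duhamel_sum (hS : IsC0Semigroup S) {ω t : ℝ} (ht : t ∈ Icc 0 T) {ι : Type*}
    (s : Finset ι) {f : ι → ℝ → H} (hf : ∀ i ∈ s, ContinuousOn (f i) (Icc 0 T)) :
    duhamel S B ω (fun τ => ∑ i ∈ s, f i τ) t = ∑ i ∈ s, duhamel S B ω (f i) t := by
  simp only [duhamel, Finset.smul_sum, map_sum]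
  exact intervalIntegral.integral_finsetSum fun i hi =>
    hS.intervalIntegrable_conv ht (continuousOn_duhamel_integrand (hf i hi))

theorem continuousOn_nestedT (hS : IsC0Semigroup S) (hT : 0 ≤ T) (ω : ℝ) (u₀ : H) (d : ℕ) :
    ContinuousOn (nestedT S B ω u₀ d) (Icc 0 T) := by
  induction d with
  | zero => exact (hS.cont u₀).mono fun _ hx => hx.1
  | succ d ih => exact continuousOn_duhamel hS hT ω ih

/-- Level count: F_l spends k_1 + … + k_l, the semigroup nothing, and N the remaining k_{l+1} + … +
k_d. -/
theorem expTerm_spec (hS : IsC0Semigroup S) (hL : IsGenerator L S)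
    (hG : IsRegularityScale L S B n T G) (hT : 0 ≤ T) {u₀ : H} (hu₀ : G n fun _ => u₀) {k : ℕ → ℕ}
    {d l : ℕ} (hl : l ≤ d) (hk : ∑ i ∈ Finset.Icc 1 d, k i ≤ n) :
    u₀ ∈ (opF L B k l).domain ∧
      (∀ t ∈ Icc 0 T, S t (papply (opF L B k l) u₀) ∈ (opN L B k (l + 1) d).domain) ∧
      ContinuousOn (expTerm L S B u₀ k d l) (Icc 0 T) := by
  have e := sum_Icc_add_sum_Icc k hl
  obtain ⟨h1, h2, -⟩ := opF_spec hS hL hG hT k l (j := ∑ i ∈ Finset.Icc (l + 1) d, k i)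
    (by omega) (hG.of_le (by omega) hu₀)
  have h3 := hG.semigroup (by omega) h2
  have hN := HasOrder.opN hS hL hG k l d
  exact ⟨h1, hN.mem_domain (by omega) h3, hN.continuousOn hG (by omega) h3⟩

/-- One Duhamel integral of a term of the expansion, integrated by parts `K` times. -/
theorem duhamel_expTerm (hS : IsC0Semigroup S) (hL : IsGenerator L S)
    (hG : IsRegularityScale L S B n T G) (hT : 0 ≤ T) {u₀ : H} (hu₀ : G n fun _ => u₀) {k : ℕ → ℕ}
    {d l K : ℕ} (hl : l ≤ d) (hk : ∑ i ∈ Finset.Icc 1 d, k i + K ≤ n) {ω : ℝ} (hω : 0 < ω) {t : ℝ}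
    (ht : t ∈ Icc 0 T) :
    duhamel S B ω (fun τ => Complex.exp (((d - l : ℕ) : ℂ) * Complex.I * ω * τ) •
        expTerm L S B u₀ k d l τ) t =
      ∑ j ∈ Finset.range K, ((((d + 1 - l : ℕ) : ℂ) * Complex.I * ω) ^ (j + 1))⁻¹ •
        (Complex.exp (((d + 1 - l : ℕ) : ℂ) * Complex.I * ω * t) •
            expTerm L S B u₀ (Function.update k (d + 1) j) (d + 1) l t -
          S t (papply (opN L B (Function.update k (d + 1) j) (l + 1) (d + 1))
            (papply (opF L B (Function.update k (d + 1) j) l) u₀))) +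
      ((((d + 1 - l : ℕ) : ℂ) * Complex.I * ω) ^ K)⁻¹ • ∫ τ in (0 : ℝ)..t,
        Complex.exp (((d + 1 - l : ℕ) : ℂ) * Complex.I * ω * τ) •
          S (t - τ) (expTerm L S B u₀ (Function.update k (d + 1) K) (d + 1) l τ) := by
  have e := sum_Icc_add_sum_Icc k hl
  -- The vector F_l u₀ must retain enough levels for N and for K further commutators.
  obtain ⟨h1, h2, -⟩ := opF_spec hS hL hG hT k l (j := ∑ i ∈ Finset.Icc (l + 1) d, k i + K)
    (by omega) (hG.of_le (by omega) hu₀)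
  have hN := HasOrder.opN hS hL hG k l d
  have hA := (HasOrder.ofBounded hG).pcomp hG hN
  rw [zero_add] at hA
  -- Absence of resonance: the frequency multiple d+1-l is positive because l ≤ d.
  have hc : ((d + 1 - l : ℕ) : ℂ) * Complex.I * ω ≠ 0 := by
    refine mul_ne_zero (mul_ne_zero ?_ Complex.I_ne_zero) (by exact_mod_cast hω.ne')
    exact_mod_cast (by omega : d + 1 - l ≠ 0)
  have key := hA.integral_exp_smul_iterate hS hL hG K (by omega) h2 hc ht
  simp only [expTerm, opN_update L B k hl, opF_update L B k hl]
  rw [← key]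
  refine intervalIntegral.integral_congr fun τ hτ => ?_
  rw [uIcc_of_le ht.1] at hτ
  have hτ' : τ ∈ Icc 0 T := ⟨hτ.1, hτ.2.trans ht.2⟩
  have h3 := (papply_pcomp (g := ofBounded B) ((expTerm_spec hS hL hG hT hu₀ (k := k) hl
    (by omega)).2.1 τ hτ') (mem_ofBounded_domain B _)).2
  have h4 : Complex.exp (Complex.I * ω * τ) *
      Complex.exp (((d - l : ℕ) : ℂ) * Complex.I * ω * τ) =
      Complex.exp (((d + 1 - l : ℕ) : ℂ) * Complex.I * ω * τ) := by
    rw [← Complex.exp_add, show d + 1 - l = d - l + 1 by omega]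
    congr 1
    push_cast
    ring
  simp only [h3, papply_ofBounded, smul_smul, h4, map_smul]

/-- One Duhamel integral of all terms of the expansion that belong to the multi-index `k`. -/
theorem duhamel_sum_expTerm (hS : IsC0Semigroup S) (hL : IsGenerator L S)
    (hG : IsRegularityScale L S B n T G) (hT : 0 ≤ T) {u₀ : H} (hu₀ : G n fun _ => u₀) {k : ℕ → ℕ}
    {d s K : ℕ} (hk : ∑ i ∈ Finset.Icc 1 d, k i = s) (hK : d + s + K = n) {ω : ℝ} (hω : 0 < ω)
    {t : ℝ} (ht : t ∈ Icc 0 T) :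
    duhamel S B ω (fun τ => (1 / (Complex.I * ω) ^ (d + s)) • ∑ l ∈ Finset.range (d + 1),
      (((coefA k d (d - l) : ℚ) : ℂ) * Complex.exp (((d - l : ℕ) : ℂ) * Complex.I * ω * τ)) •
        expTerm L S B u₀ k d l τ) t =
      ∑ j ∈ Finset.range K, (1 / (Complex.I * ω) ^ (d + 1 + (s + j))) •
        ∑ l ∈ Finset.range (d + 1 + 1),
          (((coefA (Function.update k (d + 1) j) (d + 1) (d + 1 - l) : ℚ) : ℂ) *
            Complex.exp (((d + 1 - l : ℕ) : ℂ) * Complex.I * ω * t)) •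
            expTerm L S B u₀ (Function.update k (d + 1) j) (d + 1) l t +
      (1 / (Complex.I * ω) ^ n) • ∑ l ∈ Finset.range (d + 1),
        ((coefB (Function.update k (d + 1) K) (d + 1) (d + 1 - l) : ℚ) : ℂ) •
          ∫ τ in (0 : ℝ)..t, Complex.exp (((d + 1 - l : ℕ) : ℂ) * Complex.I * ω * τ) •
            S (t - τ) (expTerm L S B u₀ (Function.update k (d + 1) K) (d + 1) l τ) := by
  have hω' : (ω : ℂ) ≠ 0 := by exact_mod_cast hω.ne'
  have hexp : ∀ c : ℂ, Continuous fun τ : ℝ => Complex.exp (c * τ) := fun c => by fun_prop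
  rw [duhamel_smul, duhamel_sum hS ht]
  swap
  · intro l hl
    exact (continuousOn_const.mul (hexp _).continuousOn).smul
      (expTerm_spec hS hL hG hT hu₀ (k := k) (by simpa [Nat.lt_succ_iff] using hl)
        (by omega)).2.2
  have h1 : ∀ l ∈ Finset.range (d + 1), duhamel S B ω (fun τ => (((coefA k d (d - l) : ℚ) : ℂ) *
      Complex.exp (((d - l : ℕ) : ℂ) * Complex.I * ω * τ)) • expTerm L S B u₀ k d l τ) t =
      ((coefA k d (d - l) : ℚ) : ℂ) • duhamel S B ω (fun τ =>
        Complex.exp (((d - l : ℕ) : ℂ) * Complex.I * ω * τ) • expTerm L S B u₀ k d l τ) t := by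
    intro l _
    rw [← duhamel_smul]
    simp only [smul_smul]
  -- The summand l = d+1 has N = Id and a = 1, so it equals S t F_{d+1} u₀. Expanding F_{d+1} by its
  -- recursion turns it into the sum of the boundary terms at τ = 0.
  have h2 : ∀ j ∈ Finset.range K, ∑ l ∈ Finset.range (d + 1 + 1),
      (((coefA (Function.update k (d + 1) j) (d + 1) (d + 1 - l) : ℚ) : ℂ) *
        Complex.exp (((d + 1 - l : ℕ) : ℂ) * Complex.I * ω * t)) •
        expTerm L S B u₀ (Function.update k (d + 1) j) (d + 1) l t =
      ∑ l ∈ Finset.range (d + 1),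
        ((coefA (Function.update k (d + 1) j) (d + 1) (d + 1 - l) : ℚ) : ℂ) •
        (Complex.exp (((d + 1 - l : ℕ) : ℂ) * Complex.I * ω * t) •
            expTerm L S B u₀ (Function.update k (d + 1) j) (d + 1) l t -
          S t (papply (opN L B (Function.update k (d + 1) j) (l + 1) (d + 1))
            (papply (opF L B (Function.update k (d + 1) j) l) u₀))) := by
    intro j hj
    have hj := Finset.mem_range.1 hj
    have e := sum_Icc_update (d := d) k j
    obtain ⟨-, -, h3⟩ := opF_spec hS hL hG hT (Function.update k (d + 1) j) (d + 1) (j := 0)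
      (v := u₀) (by omega) (hG.of_le (by omega) hu₀)
    have hx : expTerm L S B u₀ (Function.update k (d + 1) j) (d + 1) (d + 1) t =
        S t (papply (opF L B (Function.update k (d + 1) j) (d + 1)) u₀) := by
      rw [expTerm, opN_of_lt L B _ (by omega), papply_pid]
    rw [Finset.sum_range_succ, Nat.sub_self, coefA_zero, hx, h3 (by omega)]
    simp only [map_neg, map_sum, map_smul, smul_sub, Finset.sum_sub_distrib, smul_smul]
    simp [sub_eq_add_neg]
  refine Eq.trans ?_ (congrArg₂ (· + ·)
    (Finset.sum_congr rfl fun j hj => congrArg _ (h2 j hj).symm) rfl)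
  rw [Finset.sum_congr rfl fun l hl => (h1 l hl).trans (congrArg _
    (duhamel_expTerm hS hL hG hT hu₀ (k := k) (K := K)
      (Nat.lt_succ_iff.1 (Finset.mem_range.1 hl)) (by omega) hω ht))]
  simp only [smul_add, Finset.smul_sum, Finset.sum_add_distrib]
  rw [Finset.sum_comm]
  congr 1
  -- Boundary terms: the powers of iω combine as (d + s) + (j + 1), and the factor (d+1-l)^{-(j+1)}
  -- enters a.
  · refine Finset.sum_congr rfl fun j _ => Finset.sum_congr rfl fun l hl => ?_
    rw [smul_smul, smul_smul, smul_smul]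
    congr 1
    obtain ⟨q, hq⟩ : ∃ q, d = l + q := ⟨d - l, by have := Finset.mem_range.1 hl; omega⟩
    rw [show d + 1 - l = q + 1 by omega, show d - l = q by omega, coefA_update]
    have hq' : ((q + 1 : ℕ) : ℂ) ≠ 0 := by exact_mod_cast Nat.succ_ne_zero q
    have hz : Complex.I * ω ≠ 0 := mul_ne_zero Complex.I_ne_zero hω'
    rw [mul_assoc _ Complex.I]
    generalize Complex.I * (ω : ℂ) = z at hz
    rw [mul_pow]
    push_cast at hq' ⊢
    field_simp
    ring
  -- Remaining integrals: here the power is d + s + K = n, the same for all k.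
  · refine Finset.sum_congr rfl fun l hl => ?_
    rw [smul_smul, smul_smul, smul_smul]
    congr 1
    obtain ⟨q, hq⟩ : ∃ q, d = l + q := ⟨d - l, by have := Finset.mem_range.1 hl; omega⟩
    rw [show d + 1 - l = q + 1 by omega, show d - l = q by omega, coefB_update, ← hK]
    have hq' : ((q + 1 : ℕ) : ℂ) ≠ 0 := by exact_mod_cast Nat.succ_ne_zero q
    have hz : Complex.I * ω ≠ 0 := mul_ne_zero Complex.I_ne_zero hω'
    rw [mul_assoc _ Complex.I]
    generalize Complex.I * (ω : ℂ) = z at hz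
    rw [mul_pow]
    push_cast at hq' ⊢
    field_simp
    ring

theorem continuousOn_exp_smul_expTerm (hS : IsC0Semigroup S) (hL : IsGenerator L S)
    (hG : IsRegularityScale L S B n T G) (hT : 0 ≤ T) {u₀ : H} (hu₀ : G n fun _ => u₀) {k : ℕ → ℕ}
    {d : ℕ} (hk : ∑ i ∈ Finset.Icc 1 d, k i ≤ n) (ω : ℝ) (c : ℂ) :
    ContinuousOn (fun t : ℝ => c • ∑ l ∈ Finset.range (d + 1),
      (((coefA k d (d - l) : ℚ) : ℂ) * Complex.exp (((d - l : ℕ) : ℂ) * Complex.I * ω * t)) •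
        expTerm L S B u₀ k d l t) (Icc 0 T) := by
  have hexp : ∀ c : ℂ, Continuous fun τ : ℝ => Complex.exp (c * τ) := fun c => by fun_prop
  refine (continuousOn_finsetSum _ fun l hl => ?_).const_smul c
  exact (continuousOn_const.mul (hexp _).continuousOn).smul
    (expTerm_spec hS hL hG hT hu₀ (by simpa [Nat.lt_succ_iff] using hl) hk).2.2

/-- Induction on d. The Duhamel integral of E_n^d is the second part of E_n^{d+1} as it stands. That
of S_n^d is integrated by parts, each k exactly as often as needed to reach the power n of 1/(iω).
-/
theorem nestedT_eq (hS : IsC0Semigroup S) (hL : IsGenerator L S)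
    (hG : IsRegularityScale L S B n T G) (hT : 0 ≤ T) {u₀ : H} (hu₀ : G n fun _ => u₀) {ω : ℝ}
    (hω : 0 < ω) {d : ℕ} (hd : d ≤ n) : ∀ t ∈ Icc 0 T,
    nestedT S B ω u₀ d t = seriesS L S B ω u₀ n d t + remE L S B ω u₀ n d t := by
  induction d with
  | zero =>
    intro t _
    rw [seriesS_eq, Finset.sum_eq_single 0]
    · simp [nestedT, remE, expTerm, opN, opF, papply_pid, coefA_zero]
    · intro s _ hs
      simp [hs]
    · simp
  | succ d ih =>
    intro t ht
    have ih := ih (by omega)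
    obtain ⟨N, rfl⟩ : ∃ N, n = d + 1 + N := ⟨n - (d + 1), by omega⟩
    -- The top value s = N+1 is included: such terms are integrated by parts zero times and go
    -- entirely into the remainder.
    have hterm : ∀ s ∈ Finset.range (N + 1 + 1), ∀ k ∈ Finset.piAntidiag (Finset.Icc 1 d) s,
        ContinuousOn (fun t : ℝ => (1 / (Complex.I * ω) ^ (d + s)) • ∑ l ∈ Finset.range (d + 1),
          (((coefA k d (d - l) : ℚ) : ℂ) *
            Complex.exp (((d - l : ℕ) : ℂ) * Complex.I * ω * t)) •
            expTerm L S B u₀ k d l t) (Icc 0 T) := by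
      intro s hs k hk
      refine continuousOn_exp_smul_expTerm hS hL hG hT hu₀ ?_ ω _
      rw [sum_Icc_of_mem_piAntidiag hk]
      have := Finset.mem_range.1 hs
      omega
    have e : d + 1 + N - d = N + 1 := by omega
    have e' : d + 1 + N - (d + 1) = N := by omega
    have hser : ContinuousOn (seriesS L S B ω u₀ (d + 1 + N) d) (Icc 0 T) := by
      rw [← e] at hterm
      exact continuousOn_finsetSum _ fun s hs => continuousOn_finsetSum _ fun k hk =>
        hterm s hs k hk
    -- By the induction hypothesis the remainder is the difference T^d - S_n^d of continuous curves,
    -- so its own recursion need not be examined.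
    have hrem : ContinuousOn (remE L S B ω u₀ (d + 1 + N) d) (Icc 0 T) :=
      ((continuousOn_nestedT hS hT ω u₀ d).sub hser).congr fun t ht => by
        exact (sub_eq_of_eq_add' (ih t ht)).symm
    have h1 : nestedT S B ω u₀ (d + 1) t = duhamel S B ω (nestedT S B ω u₀ d) t := rfl
    rw [h1, duhamel_congr ht.1 (g := fun τ => seriesS L S B ω u₀ (d + 1 + N) d τ +
        remE L S B ω u₀ (d + 1 + N) d τ) fun τ hτ => ih τ ⟨hτ.1, hτ.2.trans ht.2⟩,
      duhamel_add hS ht hser hrem, remE_succ, ← add_assoc]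
    congr 1
    rw [seriesS_eq, e', show seriesS L S B ω u₀ (d + 1 + N) d = _ from
      funext fun τ => seriesS_eq L S B ω u₀ (d + 1 + N) d τ, e]
    rw [duhamel_sum hS ht _ fun s hs => continuousOn_finsetSum _ fun k hk => hterm s hs k hk,
      sum_piAntidiag_triangle, sum_piAntidiag_diagonal, Finset.smul_sum, ← Finset.sum_add_distrib]
    refine Finset.sum_congr rfl fun s hs => ?_
    rw [duhamel_sum hS ht _ fun k hk => hterm s hs k hk, Finset.smul_sum, ← Finset.sum_add_distrib]
    refine Finset.sum_congr rfl fun k hk => ?_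
    have := Finset.mem_range.1 hs
    exact duhamel_sum_expTerm hS hL hG hT hu₀ (sum_Icc_of_mem_piAntidiag hk) (by omega) hω ht

/-! ### Bounds uniform in the frequency. -/

theorem norm_one_div_I_mul_pow {ω : ℝ} (hω : 0 < ω) (n : ℕ) :
    ‖1 / (Complex.I * (ω : ℂ)) ^ n‖ = ω⁻¹ ^ n := by
  simp [abs_of_pos hω]

theorem norm_exp_natCast_mul_I (q : ℕ) (ω t : ℝ) :
    ‖Complex.exp ((q : ℂ) * Complex.I * ω * t)‖ = 1 := by
  have : (q : ℂ) * Complex.I * ω * t = ((q * ω * t : ℝ) : ℂ) * Complex.I := by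
    push_cast; ring
  rw [this, Complex.norm_exp_ofReal_mul_I]

theorem exists_expTerm_bound (hS : IsC0Semigroup S) (hL : IsGenerator L S)
    (hG : IsRegularityScale L S B n T G) (hT : 0 ≤ T) {u₀ : H} (hu₀ : G n fun _ => u₀) {k : ℕ → ℕ}
    {d l : ℕ} (hl : l ≤ d) (hk : ∑ i ∈ Finset.Icc 1 d, k i ≤ n) :
    ∃ C : ℝ, ∀ t ∈ Icc 0 T, ‖expTerm L S B u₀ k d l t‖ ≤ C :=
  isCompact_Icc.exists_bound_of_continuousOn (expTerm_spec hS hL hG hT hu₀ hl hk).2.2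

/-- The vectors in the integrands do not depend on ω and the exponentials have modulus one, so ω
enters only through the prefactor. The Duhamel integral of the previous remainder costs a factor
M‖B‖T. -/
theorem exists_remE_bound (hS : IsC0Semigroup S) (hL : IsGenerator L S)
    (hG : IsRegularityScale L S B n T G) (hT : 0 ≤ T) {u₀ : H} (hu₀ : G n fun _ => u₀)
    {d : ℕ} (hd : d ≤ n) : ∃ C : ℝ, ∀ ω : ℝ, 0 < ω → ∀ t ∈ Icc 0 T,
    ‖remE L S B ω u₀ n d t‖ ≤ ω⁻¹ ^ n * C := by
  induction d with
  | zero => exact ⟨0, fun ω _ t _ => by simp [remE]⟩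
  | succ d ih =>
    obtain ⟨C₀, hC₀⟩ := ih (by omega)
    obtain ⟨M, hM0, hM⟩ := hS.exists_bound T
    -- Membership is placed inside the existential so that `choose` yields a total function; the
    -- value 0 off the index set is never used.
    have h1 : ∀ k l, ∃ C : ℝ, k ∈ Finset.piAntidiag (Finset.Icc 1 (d + 1)) (n - (d + 1) + 1) →
        l ∈ Finset.range (d + 1) → ∀ t ∈ Icc 0 T, ‖expTerm L S B u₀ k (d + 1) l t‖ ≤ C := by
      intro k l
      by_cases h : k ∈ Finset.piAntidiag (Finset.Icc 1 (d + 1)) (n - (d + 1) + 1) ∧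
        l ∈ Finset.range (d + 1)
      · have hl := Finset.mem_range.1 h.2
        obtain ⟨C, hC⟩ := exists_expTerm_bound hS hL hG hT hu₀ (k := k) (d := d + 1) (l := l)
          (by omega) (by rw [sum_Icc_of_mem_piAntidiag h.1]; omega)
        exact ⟨C, fun _ _ => hC⟩
      · exact ⟨0, fun a b => absurd ⟨a, b⟩ h⟩
    choose C₁ hC₁ using h1
    refine ⟨(∑ k ∈ Finset.piAntidiag (Finset.Icc 1 (d + 1)) (n - (d + 1) + 1),
      ∑ l ∈ Finset.range (d + 1), ‖((coefB k (d + 1) (d + 1 - l) : ℚ) : ℂ)‖ *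
        (M * C₁ k l * T)) + M * (‖B‖ * C₀) * T, fun ω hω t ht => ?_⟩
    rw [remE_succ, mul_add]
    refine (norm_add_le _ _).trans (add_le_add ?_ ?_)
    · rw [norm_smul, norm_one_div_I_mul_pow hω]
      refine mul_le_mul_of_nonneg_left ?_ (by positivity)
      refine (norm_sum_le _ _).trans (Finset.sum_le_sum fun k hk => ?_)
      refine (norm_sum_le _ _).trans (Finset.sum_le_sum fun l hl => ?_)
      rw [norm_smul]
      refine mul_le_mul_of_nonneg_left ?_ (norm_nonneg _)
      have hC := hC₁ k l hk hl
      have hC0 : 0 ≤ C₁ k l := (norm_nonneg _).trans (hC t ht)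
      have h : ‖∫ τ in (0 : ℝ)..t, Complex.exp (((d + 1 - l : ℕ) : ℂ) * Complex.I * ω * τ) •
          S (t - τ) (expTerm L S B u₀ k (d + 1) l τ)‖ ≤ M * C₁ k l * |t - 0| := by
        refine intervalIntegral.norm_integral_le_of_norm_le_const fun τ hτ => ?_
        rw [uIoc_of_le ht.1] at hτ
        rw [norm_smul, norm_exp_natCast_mul_I, one_mul]
        exact (S (t - τ)).le_of_opNorm_le_of_le
          (hM _ ⟨sub_nonneg.2 hτ.2, by linarith [ht.2, hτ.1]⟩) (hC τ ⟨hτ.1.le, hτ.2.trans ht.2⟩)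
      rw [sub_zero, abs_of_nonneg ht.1] at h
      exact h.trans (mul_le_mul_of_nonneg_left ht.2 (by positivity))
    · refine (norm_duhamel_le hM ht (hC₀ ω hω)).trans_eq ?_
      ring

/-- With n = d the series reduces to |k| = 0, whose factor is ω^{-d}, and the remainder has the same
order. Since n may be chosen freely, only d levels of regularity are needed. -/
theorem exists_nestedT_bound (hS : IsC0Semigroup S) (hL : IsGenerator L S) {d : ℕ}
    (hG : IsRegularityScale L S B d T G) (hT : 0 ≤ T) {u₀ : H} (hu₀ : G d fun _ => u₀) :
    ∃ C : ℝ, ∀ ω : ℝ, 0 < ω → ∀ t ∈ Icc 0 T, ‖nestedT S B ω u₀ d t‖ ≤ ω⁻¹ ^ d * C := by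
  obtain ⟨C₀, hC₀⟩ := exists_remE_bound hS hL hG hT hu₀ le_rfl
  have h1 : ∀ k l, ∃ C : ℝ, k ∈ Finset.piAntidiag (Finset.Icc 1 d) 0 →
      l ∈ Finset.range (d + 1) → ∀ t ∈ Icc 0 T, ‖expTerm L S B u₀ k d l t‖ ≤ C := by
    intro k l
    by_cases h : k ∈ Finset.piAntidiag (Finset.Icc 1 d) 0 ∧ l ∈ Finset.range (d + 1)
    · have hl := Finset.mem_range.1 h.2
      obtain ⟨C, hC⟩ := exists_expTerm_bound hS hL hG hT hu₀ (k := k) (d := d) (l := l)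
        (by omega) (by rw [sum_Icc_of_mem_piAntidiag h.1]; omega)
      exact ⟨C, fun _ _ => hC⟩
    · exact ⟨0, fun a b => absurd ⟨a, b⟩ h⟩
  choose C₁ hC₁ using h1
  refine ⟨(∑ k ∈ Finset.piAntidiag (Finset.Icc 1 d) 0, ∑ l ∈ Finset.range (d + 1),
    ‖((coefA k d (d - l) : ℚ) : ℂ)‖ * C₁ k l) + C₀, fun ω hω t ht => ?_⟩
  rw [nestedT_eq hS hL hG hT hu₀ hω le_rfl t ht, mul_add, seriesS_eq, Nat.sub_self, zero_add,
    Finset.sum_range_one, ← Finset.smul_sum, add_zero]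
  refine (norm_add_le _ _).trans (add_le_add ?_ (hC₀ ω hω t ht))
  rw [norm_smul, norm_one_div_I_mul_pow hω]
  refine mul_le_mul_of_nonneg_left ?_ (by positivity)
  refine (norm_sum_le _ _).trans (Finset.sum_le_sum fun k hk => ?_)
  refine (norm_sum_le _ _).trans (Finset.sum_le_sum fun l hl => ?_)
  rw [norm_smul, norm_mul, norm_exp_natCast_mul_I, mul_one]
  exact mul_le_mul_of_nonneg_left (hC₁ k l hk hl t ht) (norm_nonneg _)

end Expansion

end OscInt
namespace OscInt

section WeakDerivatives

open scoped ContDiff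

variable {m : ℕ} {Ω : Set (Space m)}

/-! ### Test functions -/

/-- Real test functions on `Ω`. -/
structure IsTestFunction (Ω : Set (Space m)) (φ : Space m → ℝ) : Prop where
  contDiff : ContDiff ℝ ∞ φ
  hasCompactSupport : HasCompactSupport φ
  tsupport_subset : tsupport φ ⊆ Ω

theorem contDiff_partialDeriv (i : Fin m) {φ : Space m → ℝ} (hφ : ContDiff ℝ ∞ φ) :
    ContDiff ℝ ∞ (partialDeriv i φ) :=
  (hφ.fderiv_right (m := ∞) (by simp)).clm_apply contDiff_const

theorem IsTestFunction.partialDeriv {φ : Space m → ℝ} (hφ : IsTestFunction Ω φ) (i : Fin m) :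
    IsTestFunction Ω (partialDeriv i φ) where
  contDiff := contDiff_partialDeriv i hφ.contDiff
  hasCompactSupport := hφ.hasCompactSupport.fderiv_apply ℝ _
  tsupport_subset := (tsupport_fderiv_apply_subset ℝ _).trans hφ.tsupport_subset

theorem partialDeriv_comm (i j : Fin m) {φ : Space m → ℝ} (hφ : ContDiff ℝ ∞ φ) :
    partialDeriv i (partialDeriv j φ) = partialDeriv j (partialDeriv i φ) := by
  have h : ∀ i j : Fin m, ∀ x, partialDeriv i (partialDeriv j φ) x =
      fderiv ℝ (fderiv ℝ φ) x (EuclideanSpace.single i 1) (EuclideanSpace.single j 1) := by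
    intro i j x
    have hd : DifferentiableAt ℝ (fderiv ℝ φ) x :=
      ((hφ.fderiv_right (m := ∞) (by simp)).differentiable (by simp)) x
    have : HasFDerivAt (partialDeriv j φ) _ x :=
      hd.hasFDerivAt.clm_apply (hasFDerivAt_const (EuclideanSpace.single j (1 : ℝ)) x)
    rw [partialDeriv, this.fderiv]
    simp
  funext x
  rw [h i j x, h j i x]
  exact (hφ.contDiffAt.isSymmSndFDerivAt (by
    rw [minSmoothness_of_isRCLikeNormedField]
    exact ENat.LEInfty.out)) _ _

/-- Iterated partial derivatives along a list of coordinates. -/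
def listDeriv (l : List (Fin m)) (β : Fin m → ℕ) (φ : Space m → ℝ) : Space m → ℝ :=
  l.foldr (fun i ψ => (partialDeriv i)^[β i] ψ) φ

theorem listDeriv_cons (i : Fin m) (l : List (Fin m)) (β : Fin m → ℕ) (φ : Space m → ℝ) :
    listDeriv (i :: l) β φ = (partialDeriv i)^[β i] (listDeriv l β φ) := rfl

theorem contDiff_iterate_partialDeriv (i : Fin m) (k : ℕ) {φ : Space m → ℝ}
    (hφ : ContDiff ℝ ∞ φ) : ContDiff ℝ ∞ ((partialDeriv i)^[k] φ) := by
  induction k with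
  | zero => exact hφ
  | succ k ih =>
    rw [Function.iterate_succ_apply']
    exact contDiff_partialDeriv i ih

theorem contDiff_listDeriv (l : List (Fin m)) (β : Fin m → ℕ) {φ : Space m → ℝ}
    (hφ : ContDiff ℝ ∞ φ) : ContDiff ℝ ∞ (listDeriv l β φ) := by
  induction l with
  | nil => exact hφ
  | cons i l ih => exact contDiff_iterate_partialDeriv i _ ih

theorem iterate_partialDeriv_comm (i j : Fin m) (k : ℕ) {φ : Space m → ℝ} (hφ : ContDiff ℝ ∞ φ) :
    (partialDeriv j)^[k] (partialDeriv i φ) = partialDeriv i ((partialDeriv j)^[k] φ) := by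
  induction k with
  | zero => rfl
  | succ k ih =>
    rw [Function.iterate_succ_apply', Function.iterate_succ_apply', ih,
      partialDeriv_comm j i (contDiff_iterate_partialDeriv j k hφ)]

theorem listDeriv_add_single_of_notMem (l : List (Fin m)) (β : Fin m → ℕ) {i : Fin m} (hi : i ∉ l)
    (φ : Space m → ℝ) : listDeriv l (β + Pi.single i 1) φ = listDeriv l β φ := by
  induction l with
  | nil => rfl
  | cons j l ih =>
    obtain ⟨h1, h2⟩ := not_or.1 (mt List.mem_cons.2 hi)
    rw [listDeriv_cons, listDeriv_cons, ih h2, Pi.add_apply, Pi.single_eq_of_ne (Ne.symm h1),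
      add_zero]

/-- Coordinates are differentiated in a fixed order, so the additional ∂_i has to be commuted past
the coordinates preceding i. Without repetitions in the list it is inserted exactly once. -/
theorem listDeriv_add_single {l : List (Fin m)} (hl : l.Nodup) (β : Fin m → ℕ) {i : Fin m}
    (hi : i ∈ l) {φ : Space m → ℝ} (hφ : ContDiff ℝ ∞ φ) :
    listDeriv l (β + Pi.single i 1) φ = partialDeriv i (listDeriv l β φ) := by
  induction l with
  | nil => simp at hi
  | cons j l ih =>
    obtain ⟨h1, h2⟩ := List.nodup_cons.1 hl
    by_cases hij : i = j
    · subst hij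
      rw [listDeriv_cons, listDeriv_cons, listDeriv_add_single_of_notMem l β h1, Pi.add_apply,
        Pi.single_eq_same, Function.iterate_succ_apply']
    · rw [listDeriv_cons, listDeriv_cons, ih h2 ((List.mem_cons.1 hi).resolve_left hij),
        Pi.add_apply, Pi.single_eq_of_ne (Ne.symm hij), add_zero,
        iterate_partialDeriv_comm i j _ (contDiff_listDeriv l β hφ)]

theorem multiDeriv_zero (φ : Space m → ℝ) : multiDeriv 0 φ = φ := by
  have : ∀ l : List (Fin m), listDeriv l 0 φ = φ := by
    intro l
    induction l with
    | nil => rfl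
    | cons i l ih => rw [listDeriv_cons, ih]; rfl
  exact this _

theorem multiDeriv_add_single (β : Fin m → ℕ) (i : Fin m) {φ : Space m → ℝ}
    (hφ : ContDiff ℝ ∞ φ) : multiDeriv (β + Pi.single i 1) φ = partialDeriv i (multiDeriv β φ) :=
  listDeriv_add_single (List.nodup_finRange m) β (List.mem_finRange i) hφ

theorem multiDeriv_single (i : Fin m) {φ : Space m → ℝ} (hφ : ContDiff ℝ ∞ φ) :
    multiDeriv (Pi.single i 1) φ = partialDeriv i φ := by
  have := multiDeriv_add_single 0 i hφ
  rwa [zero_add, multiDeriv_zero] at this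

theorem IsTestFunction.multiDeriv {φ : Space m → ℝ} (hφ : IsTestFunction Ω φ) (β : Fin m → ℕ) :
    IsTestFunction Ω (multiDeriv β φ) := by
  have hi : ∀ (i : Fin m) (k : ℕ) {ψ : Space m → ℝ}, IsTestFunction Ω ψ →
      IsTestFunction Ω ((OscInt.partialDeriv i)^[k] ψ) := by
    intro i k ψ hψ
    induction k with
    | zero => exact hψ
    | succ k ih =>
      rw [Function.iterate_succ_apply']
      exact ih.partialDeriv i
  have hl : ∀ l : List (Fin m), IsTestFunction Ω (listDeriv l β φ) := by
    intro l
    induction l with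
    | nil => exact hφ
    | cons i l ih => exact hi i _ ih
  exact hl _

theorem sum_add_single (β : Fin m → ℕ) (i : Fin m) :
    ∑ j, (β + Pi.single i 1 : Fin m → ℕ) j = ∑ j, β j + 1 := by
  simp [Finset.sum_add_distrib]

theorem exists_eq_add_single {β : Fin m → ℕ} {s : ℕ} (hβ : ∑ i, β i = s + 1) :
    ∃ (γ : Fin m → ℕ) (i : Fin m), β = γ + Pi.single i 1 ∧ ∑ j, γ j = s := by
  obtain ⟨i, -, hi⟩ : ∃ i ∈ Finset.univ, β i ≠ 0 := by
    by_contra! h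
    rw [Finset.sum_eq_zero h] at hβ
    omega
  have e : β = (β - Pi.single i 1) + Pi.single i 1 := by
    funext j
    by_cases hj : j = i
    · subst hj; simp; omega
    · simp [hj]
  refine ⟨β - Pi.single i 1, i, e, ?_⟩
  have := sum_add_single (β - Pi.single i 1) i
  rw [← e] at this
  omega

/-! ### Weak derivatives -/

theorem IsTestFunction.integrable_smul {φ : Space m → ℝ} (hφ : IsTestFunction Ω φ)
    {f : Space m → ℂ} (hf : LocallyIntegrable f (volume.restrict Ω)) :
    IntegrableOn (fun x => φ x • f x) Ω :=
  hf.integrable_smul_left_of_hasCompactSupport hφ.contDiff.continuous hφ.hasCompactSupport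

theorem locallyIntegrable_Lp {q : ℝ≥0∞} (hq : 1 ≤ q) (f : Lp ℂ q (volume.restrict Ω)) :
    LocallyIntegrable f (volume.restrict Ω) :=
  (Lp.memLp f).locallyIntegrable hq

theorem locallyIntegrable_L2 (f : L2 Ω) : LocallyIntegrable f (volume.restrict Ω) :=
  locallyIntegrable_Lp (by norm_num) f

namespace HasWeakDeriv

variable {β : Fin m → ℕ} {i : Fin m} {f f' g g' h : Space m → ℂ}

theorem congr_ae (H : HasWeakDeriv Ω β f g) (hf : f =ᵐ[volume.restrict Ω] f')
    (hg : g =ᵐ[volume.restrict Ω] g') : HasWeakDeriv Ω β f' g' := by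
  intro φ h1 h2 h3
  rw [← integral_congr_ae (hf.mono fun x hx => congrArg (OscInt.multiDeriv β φ x • ·) hx),
    ← integral_congr_ae (hg.mono fun x hx => congrArg (φ x • ·) hx), H φ h1 h2 h3]

protected theorem zero (f : Space m → ℂ) : HasWeakDeriv Ω 0 f f := by
  intro φ _ _ _
  simp [multiDeriv_zero]

theorem single_iff : HasWeakDeriv Ω (Pi.single i 1) f g ↔ ∀ φ, IsTestFunction Ω φ →
    ∫ x in Ω, partialDeriv i φ x • f x = -∫ x in Ω, φ x • g x := by
  refine ⟨fun H φ hφ => ?_, fun H φ h1 h2 h3 => ?_⟩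
  · have := H φ hφ.1 hφ.2 hφ.3
    simpa [multiDeriv_single i hφ.1] using this
  · have := H φ ⟨h1, h2, h3⟩
    simpa [multiDeriv_single i h1] using this

theorem trans_single (H : HasWeakDeriv Ω (Pi.single i 1) f g) (H' : HasWeakDeriv Ω β g h) :
    HasWeakDeriv Ω (β + Pi.single i 1) f h := by
  intro φ h1 h2 h3
  have hφ : IsTestFunction Ω φ := ⟨h1, h2, h3⟩
  rw [multiDeriv_add_single β i h1, single_iff.1 H _ (hφ.multiDeriv β), H' φ h1 h2 h3,
    sum_add_single, pow_succ]
  ring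

/-- The defining identity of ∂_i f is tested with ∂^β φ. Higher derivatives of f thereby become
derivatives of ∂_i f, which permits induction on the order. -/
theorem of_add_single (H : HasWeakDeriv Ω (Pi.single i 1) f g)
    (H' : HasWeakDeriv Ω (β + Pi.single i 1) f h) : HasWeakDeriv Ω β g h := by
  intro φ h1 h2 h3
  have hφ : IsTestFunction Ω φ := ⟨h1, h2, h3⟩
  have := H' φ h1 h2 h3
  rw [multiDeriv_add_single β i h1, single_iff.1 H _ (hφ.multiDeriv β), sum_add_single,
    pow_succ] at this
  linear_combination -this

theorem add (hf : LocallyIntegrable f (volume.restrict Ω))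
    (hf' : LocallyIntegrable f' (volume.restrict Ω))
    (hg : LocallyIntegrable g (volume.restrict Ω)) (hg' : LocallyIntegrable g' (volume.restrict Ω))
    (H : HasWeakDeriv Ω β f g) (H' : HasWeakDeriv Ω β f' g') :
    HasWeakDeriv Ω β (f + f') (g + g') := by
  intro φ h1 h2 h3
  have hφ : IsTestFunction Ω φ := ⟨h1, h2, h3⟩
  simp only [Pi.add_apply, smul_add]
  rw [integral_add ((hφ.multiDeriv β).integrable_smul hf) ((hφ.multiDeriv β).integrable_smul hf'),
    integral_add (hφ.integrable_smul hg) (hφ.integrable_smul hg'), H φ h1 h2 h3, H' φ h1 h2 h3,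
    mul_add]

theorem smul (c : ℂ) (H : HasWeakDeriv Ω β f g) : HasWeakDeriv Ω β (c • f) (c • g) := by
  intro φ h1 h2 h3
  simp only [Pi.smul_apply, smul_comm _ c]
  rw [integral_smul, integral_smul, H φ h1 h2 h3, smul_eq_mul, smul_eq_mul]
  ring

theorem unique (hΩ : IsOpen Ω) (hg : LocallyIntegrable g (volume.restrict Ω))
    (hg' : LocallyIntegrable g' (volume.restrict Ω)) (H : HasWeakDeriv Ω β f g)
    (H' : HasWeakDeriv Ω β f g') : g =ᵐ[volume.restrict Ω] g' := by
  have key := hΩ.ae_eq_zero_of_integral_contDiff_smul_eq_zero (f := g - g')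
    (μ := volume.restrict Ω) ((hg.sub hg').locallyIntegrableOn Ω) fun φ h1 h2 h3 => by
      have hφ : IsTestFunction Ω φ := ⟨h1, h2, h3⟩
      simp only [Pi.sub_apply, smul_sub]
      rw [integral_sub (hφ.integrable_smul hg) (hφ.integrable_smul hg'), sub_eq_zero]
      have := (H φ h1 h2 h3).symm.trans (H' φ h1 h2 h3)
      exact mul_left_cancel₀ (pow_ne_zero _ (by norm_num)) this
  filter_upwards [key, ae_restrict_mem hΩ.measurableSet] with x hx hx'
  exact sub_eq_zero.1 (hx hx')

end HasWeakDeriv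

/-- Complex test functions may be used in the definition of first order weak derivatives. -/
theorem HasWeakDeriv.integral_fderiv_mul {i : Fin m} {f g : Space m → ℂ}
    (hf : LocallyIntegrable f (volume.restrict Ω)) (hg : LocallyIntegrable g (volume.restrict Ω))
    (H : HasWeakDeriv Ω (Pi.single i 1) f g) {ψ : Space m → ℂ} (h1 : ContDiff ℝ ∞ ψ)
    (h2 : HasCompactSupport ψ) (h3 : tsupport ψ ⊆ Ω) :
    ∫ x in Ω, fderiv ℝ ψ x (EuclideanSpace.single i 1) * f x = -∫ x in Ω, ψ x * g x := by
  have hre : IsTestFunction Ω fun x => (ψ x).re :=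
    ⟨Complex.reCLM.contDiff.comp h1, h2.comp_left (g := Complex.re) rfl,
      (tsupport_comp_subset (g := Complex.re) rfl ψ).trans h3⟩
  have him : IsTestFunction Ω fun x => (ψ x).im :=
    ⟨Complex.imCLM.contDiff.comp h1, h2.comp_left (g := Complex.im) rfl,
      (tsupport_comp_subset (g := Complex.im) rfl ψ).trans h3⟩
  have hd : ∀ x, HasFDerivAt ψ (fderiv ℝ ψ x) x := fun x =>
    (h1.differentiable (by simp) x).hasFDerivAt
  have dre : ∀ x, partialDeriv i (fun x => (ψ x).re) x =
      (fderiv ℝ ψ x (EuclideanSpace.single i 1)).re := fun x => by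
    have h : HasFDerivAt (fun x => (ψ x).re) (Complex.reCLM.comp (fderiv ℝ ψ x)) x :=
      Complex.reCLM.hasFDerivAt.comp x (hd x)
    rw [partialDeriv, h.fderiv]; rfl
  have dim : ∀ x, partialDeriv i (fun x => (ψ x).im) x =
      (fderiv ℝ ψ x (EuclideanSpace.single i 1)).im := fun x => by
    have h : HasFDerivAt (fun x => (ψ x).im) (Complex.imCLM.comp (fderiv ℝ ψ x)) x :=
      Complex.imCLM.hasFDerivAt.comp x (hd x)
    rw [partialDeriv, h.fderiv]; rfl
  have split : ∀ a b : ℂ, a * b = a.re • b + Complex.I * (a.im • b) := fun a b => by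
    rw [Complex.real_smul, Complex.real_smul]
    nth_rewrite 1 [← Complex.re_add_im a]
    ring
  have e1 := HasWeakDeriv.single_iff.1 H _ hre
  have e2 := HasWeakDeriv.single_iff.1 H _ him
  rw [integral_congr_ae (ae_of_all _ fun x => split _ (f x)),
    integral_congr_ae (ae_of_all _ fun x => split (ψ x) (g x)), integral_add, integral_add,
    integral_const_mul, integral_const_mul]
  · simp only [dre, dim] at e1 e2
    rw [e1, e2]
    ring
  · exact hre.integrable_smul hg
  · exact (him.integrable_smul hg).const_mul _
  · exact ((hre.partialDeriv i).integrable_smul hf).congr (ae_of_all _ fun x => by simp only [dre])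
  · exact (((him.partialDeriv i).integrable_smul hf).const_mul Complex.I).congr
      (ae_of_all _ fun x => by simp only [dim])

end WeakDerivatives

end OscInt
namespace OscInt

section ProductRule

open scoped ContDiff Convolution
open ContinuousLinearMap (lsmul)

variable {m : ℕ} {Ω : Set (Space m)}

/-! ### Mollification and the product rule -/

/-- A bounded representative of a function of class `L^∞(Ω)`, extended by zero. -/
theorem exists_bounded_representative (hΩ : IsOpen Ω) (a : Linf Ω) :
    ∃ (b : Space m → ℂ) (C : ℝ), StronglyMeasurable b ∧ (∀ x, ‖b x‖ ≤ C) ∧ (∀ x ∉ Ω, b x = 0) ∧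
      b =ᵐ[volume.restrict Ω] a := by
  have ha : StronglyMeasurable a := Lp.stronglyMeasurable a
  have hbd : ∀ᵐ x ∂volume.restrict Ω, ‖a x‖ ≤ ‖a‖ := by
    have h1 := ae_le_eLpNormEssSup (f := a) (μ := volume.restrict Ω)
    have h2 : eLpNormEssSup a (volume.restrict Ω) ≠ (⊤ : ℝ≥0∞) := by
      rw [← eLpNorm_exponent_top]; exact (Lp.memLp a).2.ne
    filter_upwards [h1] with x hx
    rw [Lp.norm_def, eLpNorm_exponent_top, ← toReal_enorm]
    exact ENNReal.toReal_mono h2 hx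
  have hs : MeasurableSet (Ω ∩ {x | ‖a x‖ ≤ ‖a‖}) :=
    hΩ.measurableSet.inter (measurableSet_le ha.measurable.norm measurable_const)
  refine ⟨(Ω ∩ {x | ‖a x‖ ≤ ‖a‖}).indicator a, ‖a‖, ha.indicator hs, fun x => ?_, fun x hx => ?_, ?_⟩
  · by_cases hx : x ∈ Ω ∩ {x | ‖a x‖ ≤ ‖a‖}
    · rw [indicator_of_mem hx]; exact hx.2
    · rw [indicator_of_notMem hx, norm_zero]; exact norm_nonneg _
  · exact indicator_of_notMem (fun h => hx h.1) _
  · filter_upwards [hbd, ae_restrict_mem hΩ.measurableSet] with x h1 h2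
    have h : x ∈ Ω ∩ {x | ‖a x‖ ≤ ‖a‖} := ⟨h2, h1⟩
    exact indicator_of_mem h _

/-- Bump functions whose supports shrink to the origin inside the ball of radius `δ`. -/
def shrinkingBump (δ : ℝ) (hδ : 0 < δ) (k : ℕ) : ContDiffBump (0 : Space m) where
  rIn := δ / (k + 2) / 2
  rOut := δ / (k + 2)
  rIn_pos := by positivity
  rIn_lt_rOut := half_lt_self (by positivity)

theorem tendsto_shrinkingBump {δ : ℝ} (hδ : 0 < δ) :
    Tendsto (fun k => (shrinkingBump (m := m) δ hδ k).rOut) atTop (𝓝 0) := by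
  have h : Tendsto (fun k : ℕ => (k : ℝ) + 2) atTop atTop :=
    tendsto_atTop_add_const_right _ _ tendsto_natCast_atTop_atTop
  exact h.const_div_atTop δ

theorem shrinkingBump_rOut_lt {δ : ℝ} (hδ : 0 < δ) (k : ℕ) :
    (shrinkingBump (m := m) δ hδ k).rOut < δ := by
  refine div_lt_self hδ ?_
  have : (0 : ℝ) ≤ k := Nat.cast_nonneg k
  linarith

/-- The mollification of `b`. -/
def mollify (ρ : ContDiffBump (0 : Space m)) (b : Space m → ℂ) : Space m → ℂ :=
  ρ.normed volume ⋆[lsmul ℝ ℝ, volume] b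

theorem locallyIntegrable_of_bounded {b : Space m → ℂ} {C : ℝ} (hb : StronglyMeasurable b)
    (hC : ∀ x, ‖b x‖ ≤ C) : LocallyIntegrable b :=
  (memLp_top_of_bound hb.aestronglyMeasurable C (ae_of_all _ hC)).locallyIntegrable le_top

theorem contDiff_mollify (ρ : ContDiffBump (0 : Space m)) {b : Space m → ℂ}
    (hb : LocallyIntegrable b) : ContDiff ℝ ∞ (mollify ρ b) :=
  ρ.hasCompactSupport_normed.contDiff_convolution_left _ ρ.contDiff_normed hb

theorem norm_mollify_le (ρ : ContDiffBump (0 : Space m)) {b : Space m → ℂ} {C : ℝ}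
    (hb : StronglyMeasurable b) (hC : ∀ x, ‖b x‖ ≤ C) (x : Space m) : ‖mollify ρ b x‖ ≤ C := by
  have := dist_convolution_le (x₀ := x) (z₀ := (0 : ℂ)) (R := ρ.rOut) (ε := C)
    ((norm_nonneg _).trans (hC 0)) ρ.support_normed_eq.subset ρ.nonneg_normed
    (ρ.integral_normed (μ := volume)) (hb.aestronglyMeasurable (μ := volume))
    fun y _ => by simpa using hC y
  simpa [mollify] using this

/-- Lebesgue differentiation; the outer radius is always twice the inner one, whence the constant 2.
-/
theorem ae_tendsto_mollify {δ : ℝ} (hδ : 0 < δ) {b : Space m → ℂ} (hb : LocallyIntegrable b) :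
    ∀ᵐ x, Tendsto (fun k => mollify (shrinkingBump δ hδ k) b x) atTop (𝓝 (b x)) :=
  ContDiffBump.ae_convolution_tendsto_right_of_locallyIntegrable (K := 2)
    (tendsto_shrinkingBump hδ) (Eventually.of_forall fun k => by
      simp only [shrinkingBump]; linarith) hb

/-- The derivative of a mollification is the mollification of the weak derivative. -/
theorem fderiv_mollify {i : Fin m} {a a' b b' : Space m → ℂ}
    (H : HasWeakDeriv Ω (Pi.single i 1) a a') (hb : LocallyIntegrable b)
    (hba : b =ᵐ[volume.restrict Ω] a) (hba' : b' =ᵐ[volume.restrict Ω] a')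
    (hb0 : ∀ x ∉ Ω, b x = 0) (hb0' : ∀ x ∉ Ω, b' x = 0) (ρ : ContDiffBump (0 : Space m))
    {x : Space m} (hx : Metric.closedBall x ρ.rOut ⊆ Ω) :
    fderiv ℝ (mollify ρ b) x (EuclideanSpace.single i 1) = mollify ρ b' x := by
  have hρc : HasCompactSupport (ρ.normed volume) := ρ.hasCompactSupport_normed
  have hρd : ContDiff ℝ ∞ (ρ.normed volume) := ρ.contDiff_normed
  -- The reflected kernel y ↦ ρ(x - y) is supported in the closed ball around x, hence admissible in
  -- Ω. Its y-derivative has the opposite sign, which cancels the sign in the weak derivative.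
  have hφ : IsTestFunction Ω fun y => ρ.normed volume (x - y) := by
    have e : (fun y => ρ.normed volume (x - y)) = ρ.normed volume ∘ Homeomorph.subLeft x := rfl
    refine ⟨hρd.comp (contDiff_const.sub contDiff_id), ?_, ?_⟩
    · rw [e]; exact hρc.comp_homeomorph _
    · rw [e, tsupport_comp_eq_preimage]
      intro y hy
      rw [mem_preimage, ρ.tsupport_normed_eq] at hy
      refine hx ?_
      rw [Metric.mem_closedBall, dist_comm, dist_eq_norm]
      simpa using hy
  have hd : ∀ y, HasFDerivAt (ρ.normed volume) (fderiv ℝ (ρ.normed volume) y) y := fun y =>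
    (hρd.differentiable (by simp) y).hasFDerivAt
  have hφd : ∀ y, partialDeriv i (fun y => ρ.normed volume (x - y)) y =
      -fderiv ℝ (ρ.normed volume) (x - y) (EuclideanSpace.single i 1) := by
    intro y
    have h : HasFDerivAt (fun y => ρ.normed volume (x - y)) _ y :=
      (hd (x - y)).comp y ((hasFDerivAt_id y).const_sub x)
    rw [partialDeriv, h.fderiv]
    simp
  have h1 := hρc.hasFDerivAt_convolution_left (lsmul ℝ ℝ) (hρd.of_le (by simp)) hb x
  rw [mollify, h1.fderiv]
  have hex : ConvolutionExistsAt (fderiv ℝ (ρ.normed volume)) b x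
      ((lsmul ℝ ℝ : ℝ →L[ℝ] ℂ →L[ℝ] ℂ).precompL (Space m)) volume :=
    (hρc.fderiv ℝ).convolutionExists_left _ (hρd.continuous_fderiv (by simp)) hb x
  rw [convolution_eq_swap, ContinuousLinearMap.integral_apply hex.integrable_swap, mollify,
    convolution_eq_swap]
  simp only [ContinuousLinearMap.precompL_apply, ContinuousLinearMap.lsmul_apply]
  have key := HasWeakDeriv.single_iff.1 H _ hφ
  have e1 : ∫ y, fderiv ℝ (ρ.normed volume) (x - y) (EuclideanSpace.single i 1) • b y =
      ∫ y in Ω, fderiv ℝ (ρ.normed volume) (x - y) (EuclideanSpace.single i 1) • a y := by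
    rw [← setIntegral_eq_integral_of_forall_compl_eq_zero (s := Ω)
      fun y hy => by rw [hb0 y hy, smul_zero]]
    exact integral_congr_ae (hba.mono fun y hy => congrArg
      (fderiv ℝ (ρ.normed volume) (x - y) (EuclideanSpace.single i 1) • ·) hy)
  have e2 : ∫ y, ρ.normed volume (x - y) • b' y = ∫ y in Ω, ρ.normed volume (x - y) • a' y := by
    rw [← setIntegral_eq_integral_of_forall_compl_eq_zero (s := Ω)
      fun y hy => by rw [hb0' y hy, smul_zero]]
    exact integral_congr_ae (hba'.mono fun y hy => congrArg (ρ.normed volume (x - y) • ·) hy)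
  rw [e1, e2]
  simp only [hφd, neg_smul, integral_neg, neg_inj] at key
  exact key

/-- The product rule for weak derivatives of first order. -/
theorem HasWeakDeriv.mul (hΩ : IsOpen Ω) {i : Fin m} {a a' : Linf Ω} {f f' : Space m → ℂ}
    (H : HasWeakDeriv Ω (Pi.single i 1) a a') (H' : HasWeakDeriv Ω (Pi.single i 1) f f')
    (hf : LocallyIntegrable f (volume.restrict Ω))
    (hf' : LocallyIntegrable f' (volume.restrict Ω)) :
    HasWeakDeriv Ω (Pi.single i 1) (fun x => a x * f x) (fun x => a' x * f x + a x * f' x) := by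
  obtain ⟨b, C, hbm, hbC, hb0, hba⟩ := exists_bounded_representative hΩ a
  obtain ⟨b', C', hbm', hbC', hb0', hba'⟩ := exists_bounded_representative hΩ a'
  have hb := locallyIntegrable_of_bounded hbm hbC
  have hb' := locallyIntegrable_of_bounded hbm' hbC'
  refine HasWeakDeriv.single_iff.2 fun φ hφ => ?_
  -- Mollifying at radii below δ keeps every ball centred in the support of φ inside Ω.
  obtain ⟨δ, hδ, hδΩ⟩ := hφ.hasCompactSupport.isCompact.exists_cthickening_subset_open hΩ
    hφ.tsupport_subset
  set A : ℕ → Space m → ℂ := fun k => mollify (shrinkingBump δ hδ k) b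
  set A' : ℕ → Space m → ℂ := fun k => mollify (shrinkingBump δ hδ k) b'
  have hAs : ∀ k, ContDiff ℝ ∞ (A k) := fun k => contDiff_mollify _ hb
  have hAs' : ∀ k, ContDiff ℝ ∞ (A' k) := fun k => contDiff_mollify _ hb'
  have hφC : ContDiff ℝ ∞ fun x => (φ x : ℂ) := Complex.ofRealCLM.contDiff.comp hφ.contDiff
  have hdφ : ∀ x, HasFDerivAt (fun x => (φ x : ℂ)) (Complex.ofRealCLM.comp (fderiv ℝ φ x)) x :=
    fun x => Complex.ofRealCLM.hasFDerivAt.comp x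
      (hφ.contDiff.differentiable (by simp) x).hasFDerivAt
  have hdA : ∀ k x, fderiv ℝ (fun x => (φ x : ℂ) * A k x) x (EuclideanSpace.single i 1) =
      partialDeriv i φ x * A k x + φ x * A' k x := by
    intro k x
    have hd : HasFDerivAt (fun x => (φ x : ℂ) * A k x) _ x :=
      (hdφ x).mul ((hAs k).differentiable (by simp) x).hasFDerivAt
    rw [hd.fderiv]
    -- On the support of φ the derivative of the mollification is the mollified weak derivative;
    -- elsewhere φ vanishes and nothing has to be known.
    have e : (φ x : ℂ) * fderiv ℝ (A k) x (EuclideanSpace.single i 1) = φ x * A' k x := by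
      by_cases hx : x ∈ tsupport φ
      · congr 1
        refine fderiv_mollify H hb hba hba' hb0 hb0' _ ?_
        exact ((Metric.closedBall_subset_closedBall (shrinkingBump_rOut_lt hδ k).le).trans
          (Metric.closedBall_subset_cthickening hx δ)).trans hδΩ
      · rw [image_eq_zero_of_notMem_tsupport hx]; simp
    simp only [add_apply, smul_apply, smul_eq_mul,
      ContinuousLinearMap.comp_apply, Complex.ofRealCLM_apply, e]
    rw [add_comm, mul_comm (A k x)]
    rfl
  have hcs : ∀ k, tsupport (fun x => (φ x : ℂ) * A k x) ⊆ tsupport φ := fun k =>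
    (tsupport_mul_subset_left (f := fun x => (φ x : ℂ)) (g := A k)).trans
      (tsupport_comp_subset (g := fun r : ℝ => (r : ℂ)) rfl φ)
  -- Here φ A_k is used as a complex test function against f. The product rule follows on letting k
  -- → ∞.
  have hk : ∀ k, ∫ x in Ω, (partialDeriv i φ x * A k x + φ x * A' k x) * f x =
      -∫ x in Ω, (φ x * A k x) * f' x := by
    intro k
    have := H'.integral_fderiv_mul hf hf' (ψ := fun x => (φ x : ℂ) * A k x) (hφC.mul (hAs k))
      (hφ.hasCompactSupport.isCompact.of_isClosed_subset (isClosed_tsupport _) (hcs k))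
      ((hcs k).trans hφ.tsupport_subset)
    simpa only [hdA] using this
  have hint : ∀ {ψ : Space m → ℝ}, IsTestFunction Ω ψ → ∀ {g : Space m → ℂ},
      LocallyIntegrable g (volume.restrict Ω) → ∀ D : ℝ,
      IntegrableOn (fun x => D * ‖ψ x • g x‖) Ω := fun hψ _ hg D =>
    ((hψ.integrable_smul hg).norm).const_mul D
  have hlim := (ae_restrict_of_ae (ae_tendsto_mollify hδ hb) (s := Ω))
  have hlim' := (ae_restrict_of_ae (ae_tendsto_mollify hδ hb') (s := Ω))
  have hcA : ∀ k, Continuous (A k) := fun k => (hAs k).continuous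
  have hcA' : ∀ k, Continuous (A' k) := fun k => (hAs' k).continuous
  have hcφ : Continuous fun x => (φ x : ℂ) := hφC.continuous
  have hcφ' : Continuous fun x => (partialDeriv i φ x : ℂ) :=
    Complex.continuous_ofReal.comp (hφ.partialDeriv i).contDiff.continuous
  -- Dominated convergence: mollifications converge almost everywhere and keep the bounds C and C',
  -- so f need only be locally integrable.
  have L1 : Tendsto (fun k => ∫ x in Ω, (partialDeriv i φ x * A k x + φ x * A' k x) * f x) atTop
      (𝓝 (∫ x in Ω, (partialDeriv i φ x * b x + φ x * b' x) * f x)) := by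
    refine tendsto_integral_of_dominated_convergence
      (fun x => C * ‖partialDeriv i φ x • f x‖ + C' * ‖φ x • f x‖) (fun k => ?_)
      ((hint (hφ.partialDeriv i) hf C).add (hint hφ hf C')) (fun k => ae_of_all _ fun x => ?_) ?_
    · exact ((hcφ'.mul (hcA k)).add (hcφ.mul (hcA' k))).aestronglyMeasurable.mul
        hf.aestronglyMeasurable
    · have h1 := norm_mollify_le (shrinkingBump δ hδ k) hbm hbC x
      have h2 := norm_mollify_le (shrinkingBump δ hδ k) hbm' hbC' x
      rw [add_mul]
      refine (norm_add_le _ _).trans (add_le_add ?_ ?_)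
      · rw [norm_smul, norm_mul, norm_mul, Complex.norm_real, mul_comm ‖partialDeriv i φ x‖,
          mul_assoc]
        exact mul_le_mul_of_nonneg_right h1 (by positivity)
      · rw [norm_smul, norm_mul, norm_mul, Complex.norm_real, mul_comm ‖φ x‖, mul_assoc]
        exact mul_le_mul_of_nonneg_right h2 (by positivity)
    · filter_upwards [hlim, hlim'] with x h1 h2
      exact ((h1.const_mul _).add (h2.const_mul _)).mul_const _
  have L2 : Tendsto (fun k => -∫ x in Ω, (φ x * A k x) * f' x) atTop
      (𝓝 (-∫ x in Ω, (φ x * b x) * f' x)) := by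
    refine (tendsto_integral_of_dominated_convergence
      (fun x => C * ‖φ x • f' x‖) (fun k => ?_)
      (hint hφ hf' C) (fun k => ae_of_all _ fun x => ?_) ?_).neg
    · exact (hcφ.mul (hcA k)).aestronglyMeasurable.mul hf'.aestronglyMeasurable
    · have h1 := norm_mollify_le (shrinkingBump δ hδ k) hbm hbC x
      rw [norm_smul, norm_mul, norm_mul, Complex.norm_real, mul_comm ‖φ x‖, mul_assoc]
      exact mul_le_mul_of_nonneg_right h1 (by positivity)
    · filter_upwards [hlim] with x h1
      exact (h1.const_mul _).mul_const _
  have hlast := tendsto_nhds_unique L1 ((tendsto_congr hk).2 L2)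
  have hbi : ∀ {ψ : Space m → ℝ}, IsTestFunction Ω ψ → ∀ {g c : Space m → ℂ} {D : ℝ},
      LocallyIntegrable g (volume.restrict Ω) → StronglyMeasurable c → (∀ x, ‖c x‖ ≤ D) →
      IntegrableOn (fun x => c x * (ψ x • g x)) Ω := fun hψ _ _ D hg hc hD =>
    (hψ.integrable_smul hg).bdd_mul hc.aestronglyMeasurable (ae_of_all _ hD)
  have e1 : ∫ x in Ω, (partialDeriv i φ x * b x + φ x * b' x) * f x =
      (∫ x in Ω, b x * (partialDeriv i φ x • f x)) + ∫ x in Ω, b' x * (φ x • f x) := by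
    rw [← integral_add (hbi (hφ.partialDeriv i) hf hbm hbC) (hbi hφ hf hbm' hbC')]
    refine integral_congr_ae (ae_of_all _ fun x => ?_)
    simp only [Complex.real_smul]
    ring
  have e2 : ∫ x in Ω, (φ x * b x) * f' x = ∫ x in Ω, b x * (φ x • f' x) := by
    refine integral_congr_ae (ae_of_all _ fun x => ?_)
    simp only [Complex.real_smul]
    ring
  have e3 : ∫ x in Ω, partialDeriv i φ x • (a x * f x) =
      ∫ x in Ω, b x * (partialDeriv i φ x • f x) := by
    refine integral_congr_ae (hba.mono fun x hx => ?_)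
    simp only [Complex.real_smul, hx]
    ring
  have e4 : ∫ x in Ω, φ x • (a' x * f x + a x * f' x) =
      (∫ x in Ω, b' x * (φ x • f x)) + ∫ x in Ω, b x * (φ x • f' x) := by
    rw [← integral_add (hbi hφ hf hbm' hbC') (hbi hφ hf' hbm hbC)]
    refine integral_congr_ae ((hba.and hba').mono fun x hx => ?_)
    simp only [Complex.real_smul, hx.1, hx.2]
    ring
  rw [e1, e2] at hlast
  rw [e3, e4]
  linear_combination hlast

end ProductRule

end OscInt
namespace OscInt

section SobolevCalculus

open scoped ContDiff

variable {m : ℕ} {Ω : Set (Space m)}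

/-! ### Smooth functions with bounded derivatives -/

theorem MemCbInf.partialDeriv (hΩ : IsOpen Ω) {a : Space m → ℂ} (ha : MemCbInf Ω a) (i : Fin m) :
    MemCbInf Ω fun x => fderiv ℝ a x (EuclideanSpace.single i 1) := by
  have hd : ContDiffOn ℝ ∞ (fderiv ℝ a) Ω := ha.1.fderiv_of_isOpen hΩ (by simp)
  refine ⟨hd.clm_apply contDiffOn_const, fun k => ?_⟩
  obtain ⟨C, hC⟩ := ha.2 (k + 1)
  let E : (Space m →L[ℝ] ℂ) →L[ℝ] ℂ := ContinuousLinearMap.apply ℝ ℂ (EuclideanSpace.single i 1)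
  refine ⟨‖E‖ * C, fun x hx => ?_⟩
  have h := E.norm_iteratedFDeriv_comp_left (n := k) (hd.contDiffAt (hΩ.mem_nhds hx))
    (by exact_mod_cast le_top)
  rw [norm_iteratedFDeriv_fderiv] at h
  exact h.trans (mul_le_mul_of_nonneg_left (hC x hx) (norm_nonneg _))

theorem MemCbInf.exists_Linf (hΩ : IsOpen Ω) {a : Space m → ℂ} (ha : MemCbInf Ω a) :
    ∃ b : Linf Ω, b =ᵐ[volume.restrict Ω] a := by
  obtain ⟨C, hC⟩ := ha.2 0
  have h : MemLp a (⊤ : ℝ≥0∞) (volume.restrict Ω) :=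
    memLp_top_of_bound (ha.1.continuousOn.aestronglyMeasurable hΩ.measurableSet) C
      ((ae_restrict_mem hΩ.measurableSet).mono fun x hx => by simpa using hC x hx)
  exact ⟨h.toLp, h.coeFn_toLp⟩

theorem contDiff_mul_of_tsupport_subset (hΩ : IsOpen Ω) {φ : Space m → ℝ}
    (hφ : IsTestFunction Ω φ) {a : Space m → ℂ} (ha : ContDiffOn ℝ ∞ a Ω) :
    ContDiff ℝ ∞ fun x => φ x • a x := by
  rw [contDiff_iff_contDiffAt]
  intro x
  by_cases hx : x ∈ tsupport φ
  · exact hφ.contDiff.contDiffAt.smul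
      (ha.contDiffAt (hΩ.mem_nhds (hφ.tsupport_subset hx)))
  · refine (contDiffAt_const (c := (0 : ℂ))).congr_of_eventuallyEq ?_
    filter_upwards [(isClosed_tsupport φ).isOpen_compl.mem_nhds hx] with y hy
    rw [image_eq_zero_of_notMem_tsupport hy, zero_smul]

/-- Extended by zero, φ a is smooth with compact support on the whole space, so the integral of its
partial derivative vanishes; the classical product rule does the rest. -/
theorem MemCbInf.hasWeakDeriv_single (hΩ : IsOpen Ω) {a : Space m → ℂ} (ha : MemCbInf Ω a)
    (i : Fin m) : HasWeakDeriv Ω (Pi.single i 1) a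
      fun x => fderiv ℝ a x (EuclideanSpace.single i 1) := by
  refine HasWeakDeriv.single_iff.2 fun φ hφ => ?_
  have hψ := contDiff_mul_of_tsupport_subset hΩ hφ ha.1
  have h1 := contDiff_mul_of_tsupport_subset hΩ (hφ.partialDeriv i) ha.1
  have h2 := contDiff_mul_of_tsupport_subset hΩ hφ (ha.partialDeriv hΩ i).1
  have hc : ∀ {φ : Space m → ℝ}, IsTestFunction Ω φ → ∀ b : Space m → ℂ,
      HasCompactSupport fun x => φ x • b x := fun hφ b => hφ.hasCompactSupport.smul_right
  have hsplit : ∀ x, fderiv ℝ (fun x => φ x • a x) x (EuclideanSpace.single i 1) =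
      OscInt.partialDeriv i φ x • a x + φ x • fderiv ℝ a x (EuclideanSpace.single i 1) := by
    intro x
    by_cases hx : x ∈ tsupport φ
    · have hda := (ha.1.contDiffAt (hΩ.mem_nhds (hφ.tsupport_subset hx))).differentiableAt
        (by simp)
      have hd : HasFDerivAt (fun x => φ x • a x) _ x :=
        (hφ.contDiff.differentiable (by simp) x).hasFDerivAt.smul hda.hasFDerivAt
      rw [hd.fderiv]
      simp [OscInt.partialDeriv, add_comm]
    · have h0 : (fun x => φ x • a x) =ᶠ[𝓝 x] fun _ => 0 := by
        filter_upwards [(isClosed_tsupport φ).isOpen_compl.mem_nhds hx] with y hy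
        rw [image_eq_zero_of_notMem_tsupport hy, zero_smul]
      have h0' : OscInt.partialDeriv i φ x = 0 := image_eq_zero_of_notMem_tsupport fun h =>
        hx (tsupport_fderiv_apply_subset ℝ _ h)
      rw [h0.fderiv_eq, h0', image_eq_zero_of_notMem_tsupport hx]
      simp
  have hint : ∫ x, fderiv ℝ (fun x => φ x • a x) x (EuclideanSpace.single i 1) = 0 := by
    have := integral_mul_fderiv_eq_neg_fderiv_mul_of_integrable (μ := volume) (𝕜 := ℂ)
      (f := fun _ : Space m => (1 : ℂ)) (g := fun x => φ x • a x) (v := EuclideanSpace.single i 1)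
      (by simp) ?_ ?_ (by simp) fun x _ => hψ.differentiable (by simp) x
    · simpa using this
    · simp only [one_mul, hsplit]
      exact (h1.continuous.integrable_of_hasCompactSupport (hc (hφ.partialDeriv i) a)).add
        (h2.continuous.integrable_of_hasCompactSupport (hc hφ _))
    · simpa using hψ.continuous.integrable_of_hasCompactSupport (hc hφ a)
  simp only [hsplit] at hint
  rw [integral_add (h1.continuous.integrable_of_hasCompactSupport (hc (hφ.partialDeriv i) a))
    (h2.continuous.integrable_of_hasCompactSupport (hc hφ _))] at hint
  rw [setIntegral_eq_integral_of_forall_compl_eq_zero fun x hx => ?_,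
    setIntegral_eq_integral_of_forall_compl_eq_zero fun x hx => ?_]
  · exact eq_neg_of_add_eq_zero_left hint
  · rw [image_eq_zero_of_notMem_tsupport fun h => hx (hφ.tsupport_subset h), zero_smul]
  · rw [image_eq_zero_of_notMem_tsupport fun h => hx ((hφ.partialDeriv i).tsupport_subset h),
      zero_smul]

theorem MemCbInf.exists_hasWeakDeriv (hΩ : IsOpen Ω) (s : ℕ) : ∀ {a : Space m → ℂ},
    MemCbInf Ω a → ∀ β : Fin m → ℕ, ∑ i, β i = s → ∃ g : Linf Ω, HasWeakDeriv Ω β a g := by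
  induction s with
  | zero =>
    intro a ha β hβ
    obtain ⟨b, hb⟩ := ha.exists_Linf hΩ
    have h0 : β = 0 := funext fun i => (Finset.sum_eq_zero_iff.1 hβ) i (Finset.mem_univ i)
    subst h0
    exact ⟨b, (HasWeakDeriv.zero a).congr_ae .rfl hb.symm⟩
  | succ s ih =>
    intro a ha β hβ
    obtain ⟨γ, i, rfl, hγ⟩ := exists_eq_add_single hβ
    obtain ⟨g, hg⟩ := ih (ha.partialDeriv hΩ i) γ hγ
    exact ⟨g, (ha.hasWeakDeriv_single hΩ i).trans_single hg⟩

theorem MemCbInf.exists_memWinf (hΩ : IsOpen Ω) {a : Space m → ℂ} (ha : MemCbInf Ω a) :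
    ∃ b : Linf Ω, b =ᵐ[volume.restrict Ω] a ∧ ∀ s, MemWinf Ω s b := by
  obtain ⟨b, hb⟩ := ha.exists_Linf hΩ
  refine ⟨b, hb, fun s β _ => ?_⟩
  obtain ⟨g, hg⟩ := MemCbInf.exists_hasWeakDeriv hΩ _ ha β rfl
  exact ⟨g, hg.congr_ae hb.symm .rfl⟩

theorem MemWinf.mono {s s' : ℕ} (h : s ≤ s') {α : Linf Ω} (hα : MemWinf Ω s' α) :
    MemWinf Ω s α := fun β hβ => hα β (hβ.trans h)

theorem MemWinf.exists_partialDeriv {s : ℕ} {α : Linf Ω} (hα : MemWinf Ω (s + 1) α) (i : Fin m) :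
    ∃ α' : Linf Ω, MemWinf Ω s α' ∧ HasWeakDeriv Ω (Pi.single i 1) α α' := by
  obtain ⟨α', hα'⟩ := hα (Pi.single i 1) (by simp)
  refine ⟨α', fun β hβ => ?_, hα'⟩
  obtain ⟨g, hg⟩ := hα (β + Pi.single i 1) (by rw [sum_add_single]; omega)
  exact ⟨g, hα'.of_add_single hg⟩

/-! ### Continuous families in Sobolev spaces -/

theorem mulOp_ae (α : Linf Ω) (v : L2 Ω) :
    mulOp α v =ᵐ[volume.restrict Ω] fun x => α x * v x :=
  ContinuousLinearMap.coeFn_holder (r := 2) (ContinuousLinearMap.mul ℂ ℂ) α v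

namespace ContinuousOnH

variable {s : ℕ} {u v : ℝ → L2 Ω} {J : Set ℝ}

theorem congr (hu : ContinuousOnH Ω s u J) (h : EqOn u v J) : ContinuousOnH Ω s v J := by
  intro β hβ
  obtain ⟨g, hg, hg'⟩ := hu β hβ
  exact ⟨g, hg, fun t ht => h ht ▸ hg' t ht⟩

theorem mono {s' : ℕ} (h : s ≤ s') (hu : ContinuousOnH Ω s' u J) : ContinuousOnH Ω s u J :=
  fun β hβ => hu β (hβ.trans h)

theorem memH (hu : ContinuousOnH Ω s u J) {t : ℝ} (ht : t ∈ J) : MemH Ω s (u t) := by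
  intro β hβ
  obtain ⟨g, -, hg⟩ := hu β hβ
  exact ⟨g t, hg t ht⟩

theorem add (hu : ContinuousOnH Ω s u J) (hv : ContinuousOnH Ω s v J) :
    ContinuousOnH Ω s (fun t => u t + v t) J := by
  intro β hβ
  obtain ⟨g, hg, hg'⟩ := hu β hβ
  obtain ⟨h, hh, hh'⟩ := hv β hβ
  refine ⟨fun t => g t + h t, hg.add hh, fun t ht => ?_⟩
  exact ((hg' t ht).add (locallyIntegrable_L2 _) (locallyIntegrable_L2 _) (locallyIntegrable_L2 _)
    (locallyIntegrable_L2 _) (hh' t ht)).congr_ae (Lp.coeFn_add _ _).symm (Lp.coeFn_add _ _).symm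

theorem smul (c : ℂ) (hu : ContinuousOnH Ω s u J) : ContinuousOnH Ω s (fun t => c • u t) J := by
  intro β hβ
  obtain ⟨g, hg, hg'⟩ := hu β hβ
  exact ⟨fun t => c • g t, hg.const_smul c, fun t ht => ((hg' t ht).smul c).congr_ae
    (Lp.coeFn_smul c _).symm (Lp.coeFn_smul c _).symm⟩

theorem sub (hu : ContinuousOnH Ω s u J) (hv : ContinuousOnH Ω s v J) :
    ContinuousOnH Ω s (fun t => u t - v t) J :=
  (hu.add (hv.smul (-1))).congr fun t _ => by simp [sub_eq_add_neg]

theorem zero : ContinuousOnH Ω s (fun _ => (0 : L2 Ω)) J := by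
  intro β hβ
  refine ⟨fun _ => 0, continuousOn_const, fun t _ => ?_⟩
  have h : HasWeakDeriv Ω β (0 : Space m → ℂ) 0 := fun φ _ _ _ => by simp
  exact h.congr_ae (Lp.coeFn_zero _ _ _).symm (Lp.coeFn_zero _ _ _).symm

theorem sum {ι : Type*} (A : Finset ι) {u : ι → ℝ → L2 Ω}
    (hu : ∀ i ∈ A, ContinuousOnH Ω s (u i) J) : ContinuousOnH Ω s (fun t => ∑ i ∈ A, u i t) J := by
  classical
  induction A using Finset.induction_on with
  | empty => simpa using zero
  | insert i A hi ih =>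
    simp only [Finset.sum_insert hi]
    exact (hu i (Finset.mem_insert_self i A)).add
      (ih fun k hk => hu k (Finset.mem_insert_of_mem hk))

theorem continuousOn (hΩ : IsOpen Ω) (hu : ContinuousOnH Ω s u J) : ContinuousOn u J := by
  obtain ⟨g, hg, hg'⟩ := hu 0 (by simp)
  refine hg.congr fun t ht => Lp.ext ?_
  exact HasWeakDeriv.unique hΩ (locallyIntegrable_L2 _) (locallyIntegrable_L2 _)
    (HasWeakDeriv.zero (u t)) (hg' t ht)

theorem of_continuousOn (hu : ContinuousOn u J) : ContinuousOnH Ω 0 u J := by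
  intro β hβ
  have h0 : β = 0 := funext fun i =>
    (Finset.sum_eq_zero_iff.1 (Nat.le_zero.1 hβ)) i (Finset.mem_univ i)
  subst h0
  exact ⟨u, hu, fun t _ => HasWeakDeriv.zero _⟩

theorem exists_partialDeriv (hu : ContinuousOnH Ω (s + 1) u J) (i : Fin m) :
    ∃ g : ℝ → L2 Ω, ContinuousOnH Ω s g J ∧
      ∀ t ∈ J, HasWeakDeriv Ω (Pi.single i 1) (u t) (g t) := by
  obtain ⟨g, -, hg'⟩ := hu (Pi.single i 1) (by simp)
  refine ⟨g, fun β hβ => ?_, hg'⟩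
  obtain ⟨h, hh, hh'⟩ := hu (β + Pi.single i 1) (by rw [sum_add_single]; omega)
  exact ⟨h, hh, fun t ht => (hg' t ht).of_add_single (hh' t ht)⟩

/-- Together with `exists_partialDeriv` this reduces H^{s+1} to continuity in L² and a gradient in
H^s, the form suited to induction on s. -/
theorem of_partialDeriv (hu : ContinuousOn u J)
    (h : ∀ i, ∃ g : ℝ → L2 Ω, ContinuousOnH Ω s g J ∧
      ∀ t ∈ J, HasWeakDeriv Ω (Pi.single i 1) (u t) (g t)) : ContinuousOnH Ω (s + 1) u J := by
  intro β hβ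
  obtain hβ0 | ⟨r, hr⟩ : ∑ i, β i = 0 ∨ ∃ r, ∑ i, β i = r + 1 := by
    rcases Nat.eq_zero_or_eq_succ_pred (∑ i, β i) with h | h
    · exact Or.inl h
    · exact Or.inr ⟨_, h⟩
  · exact of_continuousOn hu β hβ0.le
  · obtain ⟨γ, i, rfl, hγ⟩ := exists_eq_add_single hr
    obtain ⟨g, hg, hg'⟩ := h i
    obtain ⟨w, hw, hw'⟩ := hg γ (by omega)
    exact ⟨w, hw, fun t ht => (hg' t ht).trans_single (hw' t ht)⟩

theorem exists_deriv {r : ℕ} : ∀ {s : ℕ} {u : ℝ → L2 Ω}, ContinuousOnH Ω (s + r) u J →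
    ∀ β : Fin m → ℕ, ∑ i, β i = r → ∃ g : ℝ → L2 Ω, ContinuousOnH Ω s g J ∧
      ∀ t ∈ J, HasWeakDeriv Ω β (u t) (g t) := by
  induction r with
  | zero =>
    intro s u hu β hβ
    have h0 : β = 0 := funext fun i => (Finset.sum_eq_zero_iff.1 hβ) i (Finset.mem_univ i)
    subst h0
    exact ⟨u, hu, fun t _ => HasWeakDeriv.zero _⟩
  | succ r ih =>
    intro s u hu β hβ
    obtain ⟨γ, i, rfl, hγ⟩ := exists_eq_add_single hβ
    obtain ⟨g, hg, hg'⟩ := exists_partialDeriv (s := s + r) hu i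
    obtain ⟨w, hw, hw'⟩ := ih hg γ hγ
    exact ⟨w, hw, fun t ht => (hg' t ht).trans_single (hw' t ht)⟩

/-- Multiplication by a function of class `W^{s,∞}` acts on continuous families in `H^s`. -/
theorem mulOp (hΩ : IsOpen Ω) : ∀ {s : ℕ} {α : Linf Ω} {u : ℝ → L2 Ω}, MemWinf Ω s α →
    ContinuousOnH Ω s u J → ContinuousOnH Ω s (fun t => mulOp α (u t)) J := by
  intro s
  induction s with
  | zero =>
    intro α u _ hu
    exact of_continuousOn ((OscInt.mulOp α).continuous.comp_continuousOn (hu.continuousOn hΩ))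
  | succ s ih =>
    intro α u hα hu
    refine of_partialDeriv
      ((OscInt.mulOp α).continuous.comp_continuousOn (hu.continuousOn hΩ)) fun i => ?_
    obtain ⟨α', hα', hd⟩ := hα.exists_partialDeriv i
    obtain ⟨g, hg, hg'⟩ := hu.exists_partialDeriv i
    -- By the product rule this is the weak derivative of α u; each summand falls under the
    -- induction hypothesis at level s.
    refine ⟨fun t => OscInt.mulOp α' (u t) + OscInt.mulOp α (g t),
      (ih hα' (hu.mono (Nat.le_succ s))).add (ih (hα.mono (Nat.le_succ s)) hg), fun t ht => ?_⟩
    refine (hd.mul hΩ (hg' t ht) (locallyIntegrable_L2 _) (locallyIntegrable_L2 _)).congr_ae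
      (mulOp_ae α (u t)).symm ?_
    filter_upwards [Lp.coeFn_add (OscInt.mulOp α' (u t)) (OscInt.mulOp α (g t)),
      mulOp_ae α' (u t), mulOp_ae α (g t)] with x h1 h2 h3
    rw [h1, Pi.add_apply, h2, h3]

end ContinuousOnH

/-- A differential operator of order `p` maps continuous families in `H^{s+p}` to `H^s`. -/
theorem ContinuousOnH.of_isDiffExpr (hΩ : IsOpen Ω) {p s : ℕ} {a : (Fin m → ℕ) → Space m → ℂ}
    (ha : ∀ β, ∑ i, β i ≤ p → MemCbInf Ω (a β)) {u w : ℝ → L2 Ω} {J : Set ℝ}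
    (hu : ContinuousOnH Ω (s + p) u J) (hw : ∀ t ∈ J, IsDiffExpr Ω p a (u t) (w t)) :
    ContinuousOnH Ω s w J := by
  have h1 : ∀ β : Fin m → ℕ, ∃ (g : ℝ → L2 Ω) (b : Linf Ω), ∑ i, β i ≤ p →
      ContinuousOnH Ω s g J ∧ (∀ t ∈ J, HasWeakDeriv Ω β (u t) (g t)) ∧
      b =ᵐ[volume.restrict Ω] a β ∧ MemWinf Ω s b := by
    intro β
    by_cases hβ : ∑ i, β i ≤ p
    · obtain ⟨g, hg, hg'⟩ := (hu.mono (Nat.add_le_add_left hβ s)).exists_deriv β rfl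
      obtain ⟨b, hb, hb'⟩ := (ha β hβ).exists_memWinf hΩ
      exact ⟨g, b, fun _ => ⟨hg, hg', hb, hb' s⟩⟩
    · exact ⟨0, 0, fun h => absurd h hβ⟩
  choose g b hgb using h1
  have hmem : ∀ r ∈ Finset.range (p + 1), ∀ β ∈ Finset.piAntidiag (Finset.univ : Finset (Fin m)) r,
      ∑ i, β i ≤ p := fun r hr β hβ => by
    rw [(Finset.mem_piAntidiag.1 hβ).1]
    exact Nat.lt_succ_iff.1 (Finset.mem_range.1 hr)
  refine (ContinuousOnH.sum (Finset.range (p + 1)) fun r hr => ContinuousOnH.sum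
    (Finset.piAntidiag (Finset.univ : Finset (Fin m)) r) fun β hβ =>
      (hgb β (hmem r hr β hβ)).1.mulOp hΩ (hgb β (hmem r hr β hβ)).2.2.2).congr fun t ht => ?_
  obtain ⟨g', hg', hwt⟩ := hw t ht
  refine Lp.ext (EventuallyEq.trans ?_ hwt.symm)
  have h2 : ∀ r ∈ Finset.range (p + 1), ∀ β ∈ Finset.piAntidiag (Finset.univ : Finset (Fin m)) r,
      OscInt.mulOp (b β) (g β t) =ᵐ[volume.restrict Ω] fun x => a β x * g' β x := by
    intro r hr β hβ
    obtain ⟨-, h3, h4, -⟩ := hgb β (hmem r hr β hβ)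
    -- The derivatives witnessing `IsDiffExpr` are chosen separately for each t; uniqueness
    -- identifies them with the family that is continuous in t.
    have h5 := HasWeakDeriv.unique hΩ (locallyIntegrable_L2 _) (locallyIntegrable_L2 _) (h3 t ht)
      (hg' β (hmem r hr β hβ))
    filter_upwards [mulOp_ae (b β) (g β t), h4, h5] with x e1 e2 e3
    rw [e1, e2, e3]
  refine (Lp.coeFn_finsetSum _ _).trans ?_
  have h3 : ∀ᵐ x ∂volume.restrict Ω, ∀ r ∈ Finset.range (p + 1),
      (∑ β ∈ Finset.piAntidiag (Finset.univ : Finset (Fin m)) r, OscInt.mulOp (b β) (g β t) : L2 Ω) x =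
      ∑ β ∈ Finset.piAntidiag (Finset.univ : Finset (Fin m)) r, a β x * g' β x := by
    refine (Finset.eventually_all _).2 fun r hr => ?_
    have h4 := (Finset.eventually_all _).2 (h2 r hr)
    filter_upwards [h4, Lp.coeFn_finsetSum (Finset.piAntidiag (Finset.univ : Finset (Fin m)) r)
      fun β => OscInt.mulOp (b β) (g β t)] with x e1 e2
    rw [e2, Finset.sum_apply]
    exact Finset.sum_congr rfl e1
  filter_upwards [h3] with x hx
  rw [Finset.sum_apply]
  exact Finset.sum_congr rfl hx

/-! ### The Sobolev scale of the generator. -/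

theorem continuousOnH_const {s : ℕ} {v : L2 Ω} (hv : MemH Ω s v) (J : Set ℝ) :
    ContinuousOnH Ω s (fun _ => v) J := by
  intro β hβ
  obtain ⟨g, hg⟩ := hv β hβ
  exact ⟨fun _ => g, continuousOn_const, fun _ _ => hg⟩

/-- Continuous maps from `[0, T]` to `X_j = H^{jp}(Ω) ∩ D(L^j)`. -/
def SobolevScale (L : L2 Ω →ₗ.[ℂ] L2 Ω) (p : ℕ) (T : ℝ) (j : ℕ) (u : ℝ → L2 Ω) : Prop :=
  (∀ t ∈ Icc 0 T, u t ∈ (ppow L j).domain) ∧ ContinuousOnH Ω (j * p) u (Icc 0 T)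

/-- L loses one level because it is a differential operator of order p with C_b^∞ coefficients.
Stability under α combines the W^{np,∞} multiplier property with the assumption on boundary
conditions, and stability under the semigroup combines well-posedness with invariance of D(L^j). -/
theorem isRegularityScale_sobolevScale (hΩ : IsOpen Ω) {n p : ℕ} {T : ℝ} (hT : 0 ≤ T)
    {a : (Fin m → ℕ) → Space m → ℂ} (ha : ∀ β, ∑ i, β i ≤ p → MemCbInf Ω (a β))
    {α : Linf Ω} (hα : MemWinf Ω (n * p) α) {L : L2 Ω →ₗ.[ℂ] L2 Ω} {S : ℝ → L2 Ω →L[ℂ] L2 Ω}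
    (hS : IsC0Semigroup S) (hL : IsGenerator L S)
    (hLa : ∀ v : L.domain, MemH Ω p v → IsDiffExpr Ω p a v (L v))
    (hwp : ∀ j ≤ n, ∀ v : L2 Ω, MemH Ω (j * p) v → v ∈ (ppow L j).domain →
      ContinuousOnH Ω (j * p) (fun t => S t v) (Icc 0 T))
    (hbc : ∀ j ≤ n, ∀ v : L2 Ω, MemH Ω (j * p) v → v ∈ (ppow L j).domain →
      MemH Ω (j * p) (mulOp α v) → mulOp α v ∈ (ppow L j).domain) :
    IsRegularityScale L S (mulOp α) n T (SobolevScale L p T) where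
  congr h hu := ⟨fun t ht => h ht ▸ hu.1 t ht, hu.2.congr h⟩
  continuousOn hu := hu.2.continuousOn hΩ
  sub hu hv := ⟨fun t ht => Submodule.sub_mem _ (hu.1 t ht) (hv.1 t ht), hu.2.sub hv.2⟩
  smul c hu := ⟨fun t ht => Submodule.smul_mem _ c (hu.1 t ht), hu.2.smul c⟩
  of_succ hu := ⟨fun t ht => ppow_succ_domain_le L _ (hu.1 t ht),
    hu.2.mono (Nat.mul_le_mul_right p (Nat.le_succ _))⟩
  mem_domain hu t ht := ((mem_pcomp_domain _ _ _).1 (hu.1 t ht)).1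
  generator {j u} hu := by
    have hd : ∀ t ∈ Icc 0 T, ∃ h : u t ∈ L.domain, L ⟨u t, h⟩ ∈ (ppow L j).domain := fun t ht =>
      (mem_pcomp_domain _ _ _).1 (hu.1 t ht)
    refine ⟨fun t ht => ?_, ?_⟩
    · obtain ⟨h1, h2⟩ := hd t ht
      change papply L (u t) ∈ _
      rwa [papply_eq h1]
    · have hu2 := hu.2
      rw [Nat.succ_mul] at hu2
      refine hu2.of_isDiffExpr hΩ ha fun t ht => ?_
      obtain ⟨h1, -⟩ := hd t ht
      rw [papply_eq h1]
      exact hLa ⟨u t, h1⟩ ((hu2.mono (Nat.le_add_left p _)).memH ht)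
  mul {j u} hj hu := by
    have h := hu.2.mulOp hΩ (hα.mono (Nat.mul_le_mul_right p hj))
    exact ⟨fun t ht => hbc j hj (u t) (hu.2.memH ht) (hu.1 t ht) (h.memH ht), h⟩
  semigroup {j v} hj hv := by
    have h0 : (0 : ℝ) ∈ Icc 0 T := ⟨le_rfl, hT⟩
    exact ⟨fun t ht => hL.map_ppow_domain hS (hv.1 0 h0) ht.1,
      hwp j hj v (hv.2.memH h0) (hv.1 0 h0)⟩

end SobolevCalculus

end OscInt
end

/-! ### The theorem. -/

theorem mainTheorem2 {m : ℕ} (Ω : Set (Space m)) (hΩ : IsOpen Ω)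
    (n p : ℕ) (tstar : ℝ) (htstar : 0 < tstar)
    -- the coefficients of the differential operator and the function `α`
    (a : (Fin m → ℕ) → Space m → ℂ) (ha : ∀ β, ∑ i, β i ≤ p → MemCbInf Ω (a β))
    (α : Linf Ω) (hα : MemWinf Ω (n * p) α)
    -- `L` generates the semigroup `S t = e^{tL}` and acts as the differential operator
    (L : L2 Ω →ₗ.[ℂ] L2 Ω) (S : ℝ → L2 Ω →L[ℂ] L2 Ω)
    (hS : IsC0Semigroup S) (hL : IsGenerator L S)
    (hLa : ∀ v : L.domain, MemH Ω p v → IsDiffExpr Ω p a v (L v))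
    -- well-posedness in the Sobolev spaces
    (hwp : ∀ j ≤ n, ∀ v : L2 Ω, MemH Ω (j * p) v → v ∈ (ppow L j).domain →
      ContinuousOnH Ω (j * p) (fun t => S t v) (Icc 0 tstar))
    -- multiplication by `α` respects the boundary conditions; void if `H^p(Ω) ⊆ D(L)`
    (hbc : ∀ j ≤ n, ∀ v : L2 Ω, MemH Ω (j * p) v → v ∈ (ppow L j).domain →
      MemH Ω (j * p) (mulOp α v) → mulOp α v ∈ (ppow L j).domain)
    (u₀ : L2 Ω) (hu₀ : MemH Ω (n * p) u₀) (hu₀' : u₀ ∈ (ppow L n).domain)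
    (d : ℕ) (hd : d ≤ n) :
    -- all the terms are well defined and continuous in time
    (∀ s ≤ n - d + 1, ∀ k ∈ Finset.piAntidiag (Finset.Icc 1 d) s, ∀ l ≤ d,
      u₀ ∈ (opF L (mulOp α) k l).domain ∧
      (∀ t ∈ Icc 0 tstar,
        S t (papply (opF L (mulOp α) k l) u₀) ∈ (opN L (mulOp α) k (l + 1) d).domain) ∧
      ContinuousOn (fun t => papply (opN L (mulOp α) k (l + 1) d)
        (S t (papply (opF L (mulOp α) k l) u₀))) (Icc 0 tstar)) ∧
    -- the expansion
    (∀ ω : ℝ, 0 < ω → ∀ t ∈ Icc 0 tstar,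
      nestedT S (mulOp α) ω u₀ d t =
        seriesS L S (mulOp α) ω u₀ n d t + remE L S (mulOp α) ω u₀ n d t) ∧
    -- the bound in `Y = C([0, tstar]; L²(Ω))`, with a constant independent of `ω`
    (∀ ω : ℝ, 0 < ω → ContinuousOn (nestedT S (mulOp α) ω u₀ d) (Icc 0 tstar)) ∧
    ∃ C : ℝ, ∀ ω : ℝ, 0 < ω → ∀ t ∈ Icc 0 tstar,
      ‖nestedT S (mulOp α) ω u₀ d t‖ ≤ ω⁻¹ ^ d * C := by
  have hT := htstar.le
  have hG := isRegularityScale_sobolevScale hΩ hT ha hα hS hL hLa hwp hbc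
  have hu : SobolevScale L p tstar n fun _ => u₀ :=
    ⟨fun _ _ => hu₀', continuousOnH_const hu₀ _⟩
  refine ⟨fun s hs k hk l hl => ?_, fun ω hω => nestedT_eq hS hL hG hT hu hω hd,
    fun ω _ => continuousOn_nestedT hS hT ω u₀ d,
    exists_nestedT_bound hS hL (hG.anti hd) hT (hG.of_le hd hu)⟩
  refine expTerm_spec hS hL hG hT hu hl ?_
  -- For d ≥ 1 the bound n-d+1 is at most n. For d = 0 it is n+1, but the empty multi-index has sum
  -- 0.
  rcases Nat.eq_zero_or_pos d with rfl | hd0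
  · simp
  · rw [sum_Icc_of_mem_piAntidiag hk]
    omega
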